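/- Let $\lambda_h,\lambda_a>0$ satisfy $\lambda_a e<\lambda_h$; equivalently, $\beta:=\lambda_a/(\lambda_a+\lambda_h)<1/(1+e)$. (Normalizing time so that $\lambda_h=1$ and writing $\lambda=\lambda_a$, the condition is $\lambda e<1$.) Consider the zero-delay model. Honest blocks $j=0,1,2,\dots$ are mined at times $\tau_0<\tau_1<\cdots$ whose gaps $R_j=\tau_{j+1}-\tau_j$ are i.i.d. exponential of rate $\lambda_h$ (a Poisson process of rate $\lambda_h$). Each honest block $i$ is the root of an adversarial nothing-at-stake tree $\mathcal T_i$: the root is born at age $0$, and every block of $\mathcal T_i$, from its birth on, has children at the points of its own Poisson process of rate $\lambda_a$. All these Poisson processes and all the gaps are independent. Let $D_i(s)$ be the depth of $\mathcal T_i$ at age $s$, i.e. the largest generation of a block born by age $s$. For $s\le t$ let $A_h(t)-A_h(s)$ be the number of honest blocks mined in $(s,t]$. For $i<j$ let $$E_{ij}=\{D_i(t-\tau_i)<A_h(t)-A_h(\tau_i)\ \text{ for all } t>\tau_j\},$$ and let $F_j=\bigcap_{0\le i<j}E_{ij}$ be the adversary-proof convergence event at block $j$ (no adversarial tree rooted at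 an earlier honest block ever catches up with the honest chain after block $j$). Consider also the two-sided extension of the model, in which the honest blocks, with their trees, are indexed by $j\in\mathbb Z$, all the gaps $R_j$, $j\in\mathbb Z$, are i.i.d. exponential of rate $\lambda_h$, and all trees are independent copies as above, independent of the gaps; there put $E_j=\bigcap_{i<j}E_{ij}$, the intersection being over all integers $i<j$. Then there is a number $p>0$, depending only on $\lambda_h$ and $\lambda_a$, such that: 1. With probability $1$, $F_j$ occurs for infinitely many $j$, and the long-run frequency $\lim_{n\to\infty}\frac1n\#\{0\le j<n: F_j\text{ occurs}\}$ exists and equals $p$. 2. In the two-sided extension, $P(E_j)=p$ for every $j\in\mathbb Z$, and with probability $1$, $E_j$ occurs for infinitely many $j\ge 0$ and $\lim_{n\to\infty}\frac1n\#\{0\le j<n: E_j\text{ occurs}\}=p$. -/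

import Mathlib

open MeasureTheory ProbabilityTheory Filter Topology

namespace NaS

/-- Birth times in a nothing-at-stake tree. Blocks are labelled by finite words: `[]` is the root
and `n :: u` is the `n`-th child (counted from `0`) of the block `u`. The number `X u n` is the
waiting time between the births of the children `n - 1` and `n` of `u` (for `n = 0`: between the
birth of `u` and the birth of its first child), and the root is born at time `0`. -/
def birth (X : List ℕ → ℕ → ℝ) : List ℕ → ℝ
  | [] => 0
  | n :: u => birth X u + ∑ m ∈ Finset.range (n + 1), X u m

/-- The depth `D(t)` of the tree at age `t`: the largest generation of a block born by age `t`. -/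
noncomputable def depth (X : List ℕ → ℕ → ℝ) (t : ℝ) : ℕ∞ :=
  ⨆ (v : List ℕ) (_ : birth X v ≤ t), (v.length : ℕ∞)

/-- `A_h(t) - A_h(s)`: the number of honest blocks mined in the time interval `(s, t]`, where
`τ k` is the time at which the honest block `k` is mined. -/
noncomputable def honestCount {ι : Type*} (τ : ι → ℝ) (s t : ℝ) : ℕ∞ :=
  {k : ι | s < τ k ∧ τ k ≤ t}.encard

/-- The zero-delay model with honest rate `lamH` and adversarial rate `lamA`. The honest blocks are
indexed by `ι` (`ι = ℕ`: the process that starts with block `0`; `ι = ℤ`: its two-sided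
extension). Block `j` is mined at time `τ j`, and the gaps `τ (j + 1) - τ j` are exponential of rate
`lamH`, so that the honest blocks form a Poisson process of rate `lamH`, seen from block `0`.
The honest block `i` is the root of an adversarial tree with waiting times `X i`; these are
exponential of rate `lamA`, so that every block of that tree has children at the points of a Poisson
process of rate `lamA`. All gaps and all waiting times are jointly independent. The position
of block `0` on the time axis is left free: it plays no role. -/
structure IsZeroDelayModel {ι Ω : Type*} [Add ι] [One ι] [MeasurableSpace Ω] (lamH lamA : ℝ)
    (P : Measure Ω) (τ : ι → Ω → ℝ) (X : ι → List ℕ → ℕ → Ω → ℝ) : Prop where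
  gap_law : ∀ j, HasLaw (fun ω => τ (j + 1) ω - τ j ω) (expMeasure lamH) P
  wait_law : ∀ i u n, HasLaw (X i u n) (expMeasure lamA) P
  indep : iIndepFun
    (Sum.elim (fun (j : ι) (ω : Ω) => τ (j + 1) ω - τ j ω)
      (fun (q : ι × List ℕ × ℕ) (ω : Ω) => X q.1 q.2.1 q.2.2 ω)) P

/-- The event `E_{ij}`: after the time at which the honest block `j` is mined, the adversarial tree
rooted at the honest block `i` never catches up with the honest chain, that is,
`D_i(t - τ_i) < A_h(t) - A_h(τ_i)` for all `t > τ_j`. -/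
def neverCatchesUp {ι Ω : Type*} (τ : ι → Ω → ℝ) (X : ι → List ℕ → ℕ → Ω → ℝ) (i j : ι) : Set Ω :=
  {ω | ∀ t : ℝ, τ j ω < t →
    depth (fun u n => X i u n ω) (t - τ i ω) < honestCount (fun k => τ k ω) (τ i ω) t}

/-- The adversary-proof convergence event at the honest block `j`: no adversarial tree rooted at an
earlier honest block ever catches up after block `j`. For `ι = ℕ` this is
`F_j = ⋂_{0 ≤ i < j} E_{ij}`, for `ι = ℤ` it is `E_j = ⋂_{i < j} E_{ij}`. -/
def convergenceEvent {ι Ω : Type*} [LT ι] (τ : ι → Ω → ℝ) (X : ι → List ℕ → ℕ → Ω → ℝ) (j : ι) :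
    Set Ω :=
  ⋂ (i : ι) (_ : i < j), neverCatchesUp τ X i j

/-- The fraction of the indices `j ∈ {0, …, n - 1}` for which the event `A j` occurs at `ω`. -/
noncomputable def frequency {Ω : Type*} (A : ℕ → Set Ω) (ω : Ω) (n : ℕ) : ℝ :=
  ({j : ℕ | j < n ∧ ω ∈ A j}.ncard : ℝ) / (n : ℝ)

end NaS

namespace NaS

/-! ### The exponential distribution -/

/-! Everything is read off from the countable family of gaps and waiting times, whose joint law is
the product measure `canon`. On almost every path the honest count after block `i` equals `m`
exactly between blocks `i + m` and `i + m + 1`. So the convergence event at `j` says that no tree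
rooted at some `i < j` has, for any `m ≥ j - i`, a block of depth `m` born before block `i + m + 1`
(`forall_depth_lt_iff`).

Such a catch-up has probability at most `C * ρ ^ m` with `ρ < 1` (`exists_measure_catches_le`). It
forces either a depth-`m` block born by time `c * m`, which a first moment over all words bounds by
`(e * c * lamA) ^ m`, or `m + 1` gaps adding up to at least `c * m`, which is exponentially unlikely
if `c > 1 / lamH`. A `c` that serves both purposes exists precisely when `lamA * e < lamH`.

Three consequences follow. Positivity: catch-ups involving a distant root or a distant time are
unlikely to occur at all, and making finitely many nearby gaps short and first waiting times long
rules out the remaining ones at the cost of a positive factor (`measure_good_univ_pos`). Frequency: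
the events are stationary, and each is exponentially close to an event depending only on nearby
blocks, so covariances decay exponentially and a second-moment law of large numbers applies
(`ae_tendsto_frequency_good`). One-sided model: by Borel–Cantelli, the trees rooted before block `0`
eventually make no difference (`ae_eventually_good_iff`), so the limit `p` is the same. -/

theorem lintegral_exp_mul_expMeasure {r t : ℝ} (hr : 0 < r) (ht : t < r) :
    ∫⁻ x, ENNReal.ofReal (Real.exp (t * x)) ∂(expMeasure r) = ENNReal.ofReal (r / (r - t)) := by
  have hrt : 0 < r - t := sub_pos.2 ht
  have hpdf : Measurable (exponentialPDF r) := (measurable_exponentialPDFReal r).ennreal_ofReal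
  change ∫⁻ x, _ ∂(volume.withDensity (exponentialPDF r)) = _
  rw [lintegral_withDensity_eq_lintegral_mul _ hpdf (by fun_prop)]
  -- Exponential tilting turns the density of rate `r` into a multiple of the density of rate `r -
  -- t`.
  have key : ∀ x, (exponentialPDF r * fun x => ENNReal.ofReal (Real.exp (t * x))) x
      = ENNReal.ofReal (r / (r - t)) * exponentialPDF (r - t) x := by
    intro x
    simp only [Pi.mul_apply]
    rcases lt_or_ge x 0 with hx | hx
    · simp [exponentialPDF_of_neg hx]
    · rw [exponentialPDF_of_nonneg hx, exponentialPDF_of_nonneg hx,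
        ← ENNReal.ofReal_mul (by positivity), ← ENNReal.ofReal_mul (by positivity)]
      congr 1
      rw [mul_assoc, ← Real.exp_add, ← mul_assoc, div_mul_cancel₀ _ hrt.ne']
      congr 2
      ring
  rw [lintegral_congr key, lintegral_const_mul' _ _ ENNReal.ofReal_ne_top,
    lintegral_exponentialPDF_eq_one hrt, mul_one]

theorem integrable_exp_mul_expMeasure {r t : ℝ} (hr : 0 < r) (ht : t < r) :
    Integrable (fun x => Real.exp (t * x)) (expMeasure r) := by
  refine ⟨by fun_prop, ?_⟩
  rw [hasFiniteIntegral_iff_ofReal (ae_of_all _ fun x => (Real.exp_pos _).le),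
    lintegral_exp_mul_expMeasure hr ht]
  exact ENNReal.ofReal_lt_top

theorem integral_exp_mul_expMeasure {r t : ℝ} (hr : 0 < r) (ht : t < r) :
    ∫ x, Real.exp (t * x) ∂(expMeasure r) = r / (r - t) := by
  rw [integral_eq_lintegral_of_nonneg_ae (ae_of_all _ fun x => (Real.exp_pos _).le) (by fun_prop),
    lintegral_exp_mul_expMeasure hr ht, ENNReal.toReal_ofReal]
  have := sub_pos.2 ht
  positivity

theorem expMeasure_Iic {r : ℝ} (hr : 0 < r) {x : ℝ} (hx : 0 ≤ x) :
    (expMeasure r).real (Set.Iic x) = 1 - Real.exp (-(r * x)) := by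
  have := isProbabilityMeasure_expMeasure hr
  rw [← cdf_eq_real, cdf_expMeasure_eq hr, if_pos hx]

theorem expMeasure_Iic_pos {r : ℝ} (hr : 0 < r) {x : ℝ} (hx : 0 < x) :
    0 < expMeasure r (Set.Iic x) := by
  refine pos_iff_ne_zero.2 fun h => ?_
  have h1 := expMeasure_Iic hr hx.le
  have h2 : Real.exp (-(r * x)) < Real.exp 0 := Real.exp_lt_exp.2 (by nlinarith)
  rw [measureReal_def, h, ENNReal.toReal_zero] at h1
  rw [Real.exp_zero] at h2
  linarith

theorem expMeasure_Ioi_pos {r : ℝ} (hr : 0 < r) {x : ℝ} (hx : 0 ≤ x) :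
    0 < expMeasure r (Set.Ioi x) := by
  have := isProbabilityMeasure_expMeasure hr
  refine pos_iff_ne_zero.2 fun h => ?_
  have h1 := expMeasure_Iic hr hx
  have h2 := probReal_compl_eq_one_sub (μ := expMeasure r) (measurableSet_Iic (a := x))
  rw [Set.compl_Iic, measureReal_def, h, ENNReal.toReal_zero] at h2
  have := Real.exp_pos (-(r * x))
  linarith

theorem ae_pos_expMeasure {r : ℝ} (hr : 0 < r) : ∀ᵐ x ∂(expMeasure r), 0 < x := by
  have := isProbabilityMeasure_expMeasure hr
  rw [ae_iff]
  have h1 := expMeasure_Iic hr le_rfl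
  have h2 : {x : ℝ | ¬ 0 < x} = Set.Iic 0 := by ext; simp
  rw [h2, ← measureReal_eq_zero_iff, h1]
  simp

/-! ### Chernoff bounds for sums of independent exponential variables. -/

section Tail

variable {Ω κ : Type*} [MeasurableSpace Ω] {P : Measure Ω} {Y : κ → Ω → ℝ} {r : ℝ}

theorem mgf_sum_exp (hr : 0 < r) (hY : ∀ q, Measurable (Y q)) (hind : iIndepFun Y P)
    {s : Finset κ} (hlaw : ∀ q ∈ s, P.map (Y q) = expMeasure r) {t : ℝ} (ht : t < r) :
    mgf (∑ q ∈ s, Y q) P t = (r / (r - t)) ^ s.card := by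
  rw [hind.mgf_sum hY, ← Finset.prod_const]
  refine Finset.prod_congr rfl fun q hq => ?_
  rw [← integral_exp_mul_expMeasure hr ht, ← hlaw q hq, mgf,
    integral_map (hY q).aemeasurable (by fun_prop)]

theorem integrable_exp_mul_sum_exp (hr : 0 < r) (hY : ∀ q, Measurable (Y q))
    (hind : iIndepFun Y P) {s : Finset κ} (hlaw : ∀ q ∈ s, P.map (Y q) = expMeasure r) {t : ℝ}
    (ht : t < r) : Integrable (fun ω => Real.exp (t * (∑ q ∈ s, Y q) ω)) P := by
  have := hind.isProbabilityMeasure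
  refine hind.integrable_exp_mul_sum hY fun q hq => ?_
  have h := integrable_exp_mul_expMeasure hr ht
  rw [← hlaw q hq, integrable_map_measure (by fun_prop) (hY q).aemeasurable] at h
  exact h

theorem measure_sum_exp_le (hr : 0 < r) (hY : ∀ q, Measurable (Y q)) (hind : iIndepFun Y P)
    {s : Finset κ} (hlaw : ∀ q ∈ s, P.map (Y q) = expMeasure r) {t : ℝ} (ht : 0 ≤ t) (x : ℝ) :
    P.real {ω | (∑ q ∈ s, Y q) ω ≤ x} ≤ Real.exp (t * x) * (r / (r + t)) ^ s.card := by
  have := hind.isProbabilityMeasure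
  have h := measure_le_le_exp_mul_mgf x (neg_nonpos.2 ht)
    (integrable_exp_mul_sum_exp (t := -t) hr hY hind hlaw (by linarith))
  rwa [mgf_sum_exp hr hY hind hlaw (by linarith), neg_neg, sub_neg_eq_add] at h

theorem measure_le_sum_exp (hr : 0 < r) (hY : ∀ q, Measurable (Y q)) (hind : iIndepFun Y P)
    {s : Finset κ} (hlaw : ∀ q ∈ s, P.map (Y q) = expMeasure r) {t : ℝ} (ht : 0 ≤ t) (htr : t < r)
    (x : ℝ) :
    P.real {ω | x ≤ (∑ q ∈ s, Y q) ω} ≤ Real.exp (-t * x) * (r / (r - t)) ^ s.card := by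
  have := hind.isProbabilityMeasure
  have h := measure_ge_le_exp_mul_mgf x ht (integrable_exp_mul_sum_exp hr hY hind hlaw htr)
  rwa [mgf_sum_exp hr hY hind hlaw htr] at h

end Tail

/-! ### The first moment bound for the depth of a tree -/

/-- The waiting times that add up to the birth time of a block. -/
def waits : List ℕ → Finset (List ℕ × ℕ)
  | [] => ∅
  | n :: u => waits u ∪ (Finset.range (n + 1)).map ⟨fun m => (u, m), fun _ _ h => (Prod.mk.inj h).2⟩

theorem length_lt_of_mem_waits {v : List ℕ} {q : List ℕ × ℕ} (hq : q ∈ waits v) :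
    q.1.length < v.length := by
  induction v with
  | nil => simp [waits] at hq
  | cons n u ih =>
    simp only [waits, Finset.mem_union, Finset.mem_map] at hq
    rcases hq with hq | ⟨m, -, rfl⟩
    · exact (ih hq).trans (by simp)
    · exact Nat.lt_succ_self _

theorem disjoint_waits (n : ℕ) (u : List ℕ) : Disjoint (waits u)
    ((Finset.range (n + 1)).map ⟨fun m => (u, m), fun _ _ h => (Prod.mk.inj h).2⟩) := by
  refine Finset.disjoint_left.2 fun q hq hq' => ?_
  simp only [Finset.mem_map] at hq'
  obtain ⟨m, -, rfl⟩ := hq'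
  exact lt_irrefl _ (length_lt_of_mem_waits hq)

theorem birth_eq_sum_waits (X : List ℕ → ℕ → ℝ) (v : List ℕ) :
    birth X v = ∑ q ∈ waits v, X q.1 q.2 := by
  induction v with
  | nil => simp [waits, birth]
  | cons n u ih =>
    rw [waits, birth, Finset.sum_union (disjoint_waits n u), ih, Finset.sum_map]
    rfl

theorem card_waits_cons (n : ℕ) (u : List ℕ) : (waits (n :: u)).card = n + 1 + (waits u).card := by
  rw [waits, Finset.card_union_of_disjoint (disjoint_waits n u), Finset.card_map,
    Finset.card_range, add_comm]

/-- A letter `n` contributes `n + 1` waiting times, so the sum over words factorises letter by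
letter. -/
theorem tsum_pow_card_waits (q : ENNReal) (m : ℕ) :
    ∑' w : Fin m → ℕ, q ^ (waits (List.ofFn w)).card = (∑' n : ℕ, q ^ (n + 1)) ^ m := by
  induction m with
  | zero => simp [waits]
  | succ m ih =>
    rw [← (Fin.consEquiv (fun _ : Fin (m + 1) => ℕ)).tsum_eq, ENNReal.tsum_prod']
    have h : ∀ (n : ℕ) (w : Fin m → ℕ),
        q ^ (waits (List.ofFn ((Fin.consEquiv (fun _ : Fin (m + 1) => ℕ)) (n, w)))).card
          = q ^ (n + 1) * q ^ (waits (List.ofFn w)).card := by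
      intro n w
      change q ^ (waits (List.ofFn (Fin.cons n w : Fin (m + 1) → ℕ))).card = _
      rw [List.ofFn_cons, card_waits_cons, pow_add]
    simp_rw [h, ENNReal.tsum_mul_left, ih, ENNReal.tsum_mul_right]
    rw [pow_succ, mul_comm]

theorem tsum_geometric_exp {r t : ℝ} (hr : 0 < r) (ht : 0 < t) :
    ∑' n : ℕ, ENNReal.ofReal (r / (r + t)) ^ (n + 1) = ENNReal.ofReal (r / t) := by
  have h0 : 0 ≤ r / (r + t) := by positivity
  have h1 : r / (r + t) < 1 := by rw [div_lt_one (by positivity)]; linarith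
  simp_rw [← ENNReal.ofReal_pow h0]
  have hs : Summable fun n : ℕ => (r / (r + t)) ^ (n + 1) :=
    (summable_nat_add_iff 1).2 (summable_geometric_of_lt_one h0 h1)
  rw [← ENNReal.ofReal_tsum_of_nonneg (fun n => by positivity) hs]
  simp_rw [pow_succ]
  rw [tsum_mul_right, tsum_geometric_of_lt_one h0 h1]
  congr 1
  have h2 : 1 - r / (r + t) = t / (r + t) := by field_simp; ring
  rw [h2]
  field_simp

/-- Union bound over all words of length `m`, with the Chernoff bound for each. With `q = r / (r +
t)` the sum over words is `(∑ q ^ (n + 1)) ^ m = (r / t) ^ m`. -/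
theorem measure_exists_birth_le {Ω κ : Type*} [MeasurableSpace Ω] {P : Measure Ω} {Y : κ → Ω → ℝ}
    {r : ℝ} (hr : 0 < r) (hY : ∀ q, Measurable (Y q)) (hind : iIndepFun Y P)
    (f : List ℕ × ℕ → κ) (hf : f.Injective) (hlaw : ∀ q, P.map (Y (f q)) = expMeasure r)
    {t : ℝ} (ht : 0 < t) (x : ℝ) (m : ℕ) :
    P {ω | ∃ v : List ℕ, v.length = m ∧ birth (fun u n => Y (f (u, n)) ω) v ≤ x}
      ≤ ENNReal.ofReal (Real.exp (t * x) * (r / t) ^ m) := by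
  have := hind.isProbabilityMeasure
  have hsub : {ω | ∃ v : List ℕ, v.length = m ∧ birth (fun u n => Y (f (u, n)) ω) v ≤ x}
      ⊆ ⋃ w : Fin m → ℕ, {ω | (∑ q ∈ waits (List.ofFn w), Y (f q)) ω ≤ x} := by
    rintro ω ⟨v, rfl, hv⟩
    refine Set.mem_iUnion.2 ⟨v.get, ?_⟩
    rw [birth_eq_sum_waits] at hv
    simpa [List.ofFn_get] using hv
  have hone : ∀ w : Fin m → ℕ, P {ω | (∑ q ∈ waits (List.ofFn w), Y (f q)) ω ≤ x}
      ≤ ENNReal.ofReal (Real.exp (t * x))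
        * ENNReal.ofReal (r / (r + t)) ^ (waits (List.ofFn w)).card := by
    intro w
    rw [← ENNReal.ofReal_pow (by positivity), ← ENNReal.ofReal_mul (by positivity),
      ← ofReal_measureReal]
    exact ENNReal.ofReal_le_ofReal (measure_sum_exp_le (Y := fun q => Y (f q)) hr
      (fun q => hY _) (hind.precomp hf) (fun q _ => hlaw q) ht.le x)
  calc _ ≤ _ := measure_mono hsub
    _ ≤ _ := measure_iUnion_le _
    _ ≤ _ := ENNReal.tsum_le_tsum hone
    _ = _ := by
      rw [ENNReal.tsum_mul_left, tsum_pow_card_waits, tsum_geometric_exp hr ht,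
        ← ENNReal.ofReal_pow (by positivity), ← ENNReal.ofReal_mul (by positivity)]

/-! ### A law of large numbers for weakly correlated events -/

theorem tendsto_zero_of_tsum_integral {Ω : Type*} [MeasurableSpace Ω] {P : Measure Ω}
    {f : ℕ → Ω → ℝ} (hf : ∀ n, Integrable (f n) P) (hf0 : ∀ n ω, 0 ≤ f n ω)
    {b : ℕ → ℝ} (hb : Summable b) (hfb : ∀ n, ∫ ω, f n ω ∂P ≤ b n) :
    ∀ᵐ ω ∂P, Tendsto (fun n => f n ω) atTop (𝓝 0) := by
  have h1 : ∫⁻ ω, ∑' n, ENNReal.ofReal (f n ω) ∂P ≠ ⊤ := by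
    rw [lintegral_tsum fun n => (hf n).aestronglyMeasurable.aemeasurable.ennreal_ofReal]
    refine ne_top_of_le_ne_top hb.tsum_ofReal_ne_top (ENNReal.tsum_le_tsum fun n => ?_)
    rw [← ofReal_integral_eq_lintegral_ofReal (hf n) (ae_of_all _ (hf0 n))]
    exact ENNReal.ofReal_le_ofReal (hfb n)
  filter_upwards [ae_lt_top' (AEMeasurable.tsum fun n =>
    (hf n).aestronglyMeasurable.aemeasurable.ennreal_ofReal) h1] with ω hω
  have h2 := ENNReal.tendsto_atTop_zero_of_tsum_ne_top hω.ne
  have h3 := (ENNReal.tendsto_toReal ENNReal.zero_ne_top).comp h2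
  simpa [Function.comp_def, hf0] using h3

theorem frequency_eq {Ω : Type*} (A : ℕ → Set Ω) (ω : Ω) (n : ℕ) :
    frequency A ω n = (∑ j ∈ Finset.range n, (A j).indicator (fun _ => (1 : ℝ)) ω) / n := by
  classical
  unfold frequency
  congr 1
  have h : {j : ℕ | j < n ∧ ω ∈ A j} = ↑((Finset.range n).filter fun j => ω ∈ A j) := by
    ext; simp
  rw [h, Set.ncard_coe_finset, Finset.card_filter, Nat.cast_sum]
  exact Finset.sum_congr rfl fun j _ => by by_cases hj : ω ∈ A j <;> simp [hj]

/-- The variance grows at most linearly, because each row of the covariance matrix is bounded by the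
same convergent sum over `ℤ`. Upper bounds on the covariances are enough. -/
theorem integral_sq_sum_le {Ω : Type*} [MeasurableSpace Ω] {P : Measure Ω} [IsProbabilityMeasure P]
    {A : ℕ → Set Ω} (hA : ∀ j, MeasurableSet (A j)) {p : ℝ} (hp : ∀ j, P.real (A j) = p)
    {e : ℕ → ℝ} (he0 : ∀ d, 0 ≤ e d) (he : Summable e)
    (hcov : ∀ i j : ℕ, P.real (A i ∩ A j) ≤ p ^ 2 + e ((i : ℤ) - j).natAbs) (n : ℕ) :
    ∫ ω, (∑ j ∈ Finset.range n, ((A j).indicator (fun _ => (1 : ℝ)) ω - p)) ^ 2 ∂P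
      ≤ (∑' z : ℤ, e z.natAbs) * n := by
  have hind : ∀ j, Integrable ((A j).indicator (fun _ => (1 : ℝ))) P := fun j =>
    (integrable_const _).indicator (hA j)
  have hind2 : ∀ i j, Integrable ((A i ∩ A j).indicator (fun _ => (1 : ℝ))) P := fun i j =>
    (integrable_const _).indicator ((hA i).inter (hA j))
  have hmul : ∀ i j, (fun ω => ((A i).indicator (fun _ => (1 : ℝ)) ω - p)
      * ((A j).indicator (fun _ => (1 : ℝ)) ω - p))
      = fun ω => (A i ∩ A j).indicator (fun _ => (1 : ℝ)) ω
        - p * (A i).indicator (fun _ => (1 : ℝ)) ω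
        - p * (A j).indicator (fun _ => (1 : ℝ)) ω + p ^ 2 := by
    intro i j
    ext ω
    by_cases h1 : ω ∈ A i <;> by_cases h2 : ω ∈ A j <;> simp [h1, h2] <;> ring
  have hint : ∀ i j, Integrable (fun ω => ((A i).indicator (fun _ => (1 : ℝ)) ω - p)
      * ((A j).indicator (fun _ => (1 : ℝ)) ω - p)) P := by
    intro i j
    rw [hmul]
    exact (((hind2 i j).sub ((hind i).const_mul p)).sub ((hind j).const_mul p)).add
      (integrable_const _)
  have hval : ∀ i j, ∫ ω, ((A i).indicator (fun _ => (1 : ℝ)) ω - p)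
      * ((A j).indicator (fun _ => (1 : ℝ)) ω - p) ∂P ≤ e ((i : ℤ) - j).natAbs := by
    intro i j
    have h1 : Integrable (fun ω => (A i ∩ A j).indicator (fun _ => (1 : ℝ)) ω
        - p * (A i).indicator (fun _ => (1 : ℝ)) ω) P := (hind2 i j).sub ((hind i).const_mul p)
    have h2 : Integrable (fun ω => (A i ∩ A j).indicator (fun _ => (1 : ℝ)) ω
        - p * (A i).indicator (fun _ => (1 : ℝ)) ω - p * (A j).indicator (fun _ => (1 : ℝ)) ω) P :=
      h1.sub ((hind j).const_mul p)
    rw [hmul, integral_add h2 (integrable_const _), integral_sub h1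
      ((hind j).const_mul p), integral_sub (hind2 i j) ((hind i).const_mul p),
      integral_const_mul, integral_const_mul, integral_indicator_const _ (hA i),
      integral_indicator_const _ (hA j), integral_indicator_const _ ((hA i).inter (hA j)), hp, hp]
    have := hcov i j
    simp only [smul_eq_mul, mul_one, integral_const, probReal_univ, one_mul]
    nlinarith
  have hsumZ : Summable fun z : ℤ => e z.natAbs :=
    Summable.of_nat_of_neg (by simpa using he) (by simpa using he)
  simp_rw [pow_two, Finset.sum_mul_sum]
  rw [integral_finsetSum _ fun i _ => integrable_finsetSum _ fun j _ => hint i j]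
  have hrow : ∀ i : ℕ, ∑ j ∈ Finset.range n, e ((i : ℤ) - j).natAbs ≤ ∑' z : ℤ, e z.natAbs := by
    intro i
    have hinj : Set.InjOn (fun j : ℕ => (i : ℤ) - j) (Finset.range n : Set ℕ) := by
      intro a _ b _ hab
      simp only [sub_right_inj, Nat.cast_inj] at hab
      exact hab
    rw [← Finset.sum_image (f := fun z : ℤ => e z.natAbs) hinj]
    exact hsumZ.sum_le_tsum _ fun z _ => he0 _
  calc _ ≤ ∑ i ∈ Finset.range n, ∑' z : ℤ, e z.natAbs := by
        refine Finset.sum_le_sum fun i _ => ?_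
        rw [integral_finsetSum _ fun j _ => hint i j]
        exact (Finset.sum_le_sum fun j _ => hval i j).trans (hrow i)
    _ = _ := by simp [mul_comm]

/-- Along the squares the second moments of the deviations are summable, which gives almost sure
convergence there. Monotonicity of the partial counts fills the gaps, since consecutive squares have
ratio tending to `1`. -/
theorem ae_tendsto_frequency {Ω : Type*} [MeasurableSpace Ω] {P : Measure Ω}
    [IsProbabilityMeasure P] {A : ℕ → Set Ω} (hA : ∀ j, MeasurableSet (A j)) {p : ℝ}
    (hp : ∀ j, P.real (A j) = p) {e : ℕ → ℝ} (he0 : ∀ d, 0 ≤ e d) (he : Summable e)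
    (hcov : ∀ i j : ℕ, P.real (A i ∩ A j) ≤ p ^ 2 + e ((i : ℤ) - j).natAbs) :
    ∀ᵐ ω ∂P, Tendsto (frequency A ω) atTop (𝓝 p) := by
  set K : ℝ := ∑' z : ℤ, e z.natAbs
  set S : ℕ → Ω → ℝ := fun n ω => ∑ j ∈ Finset.range n, (A j).indicator (fun _ => (1 : ℝ)) ω
  have hS : ∀ n ω, ∑ j ∈ Finset.range n, ((A j).indicator (fun _ => (1 : ℝ)) ω - p)
      = S n ω - n * p := by
    intro n ω
    simp [S, Finset.sum_sub_distrib]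
  have hSm : ∀ n, Measurable (S n) := fun n =>
    Finset.measurable_sum _ fun j _ => measurable_const.indicator (hA j)
  have hS0 : ∀ n ω, 0 ≤ S n ω := fun n ω =>
    Finset.sum_nonneg fun j _ => Set.indicator_nonneg (fun _ _ => zero_le_one) _
  have hSn : ∀ n ω, S n ω ≤ n := by
    intro n ω
    refine (Finset.sum_le_sum fun j _ => Set.indicator_le_self' (fun _ _ => zero_le_one) ω).trans ?_
    simp
  have hint : ∀ n : ℕ, Integrable (fun ω => (S n ω - n * p) ^ 2) P := by
    intro n
    refine Integrable.of_bound (((hSm n).sub_const _).pow_const 2).aestronglyMeasurable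
      ((n + |n * p|) ^ 2) (ae_of_all _ fun ω => ?_)
    rw [Real.norm_eq_abs, abs_pow]
    gcongr
    refine (abs_sub _ _).trans ?_
    gcongr
    rw [abs_of_nonneg (hS0 n ω)]
    exact hSn n ω
  have hvar : ∀ n : ℕ, ∫ ω, (S n ω - n * p) ^ 2 ∂P ≤ K * n := by
    intro n
    have := integral_sq_sum_le hA hp he0 he hcov n
    simpa only [hS] using this
  have hsub : ∀ᵐ ω ∂P, Tendsto (fun n : ℕ => (S ((n + 1) ^ 2) ω / (((n + 1) ^ 2 : ℕ) : ℝ) - p) ^ 2)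
      atTop (𝓝 0) := by
    have heq : ∀ (n : ℕ) ω, (S ((n + 1) ^ 2) ω / (((n + 1) ^ 2 : ℕ) : ℝ) - p) ^ 2
        = (S ((n + 1) ^ 2) ω - (((n + 1) ^ 2 : ℕ) : ℝ) * p) ^ 2
          * ((((n + 1) ^ 2 : ℕ) : ℝ) ^ 2)⁻¹ := by
      intro n ω
      have : (((n + 1) ^ 2 : ℕ) : ℝ) ≠ 0 := by positivity
      field_simp
    refine tendsto_zero_of_tsum_integral (b := fun n : ℕ => K * (1 / ((n + 1 : ℕ) : ℝ) ^ 2))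
      (fun n => ?_) (fun n ω => sq_nonneg _) ?_ fun n => ?_
    · simp_rw [heq]
      exact (hint _).mul_const _
    · exact ((summable_nat_add_iff 1).2 (Real.summable_one_div_nat_pow.2 one_lt_two)).mul_left K
    · simp_rw [heq]
      rw [integral_mul_const]
      refine (mul_le_mul_of_nonneg_right (hvar _) (by positivity)).trans (le_of_eq ?_)
      push_cast
      field_simp
  filter_upwards [hsub] with ω hω
  simp_rw [funext fun n => frequency_eq A ω n]
  refine tendsto_div_of_monotone_of_exists_subseq_tendsto_div (fun n => S n ω) p ?_ ?_
  · refine monotone_nat_of_le_succ fun n => ?_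
    simp only [S, Finset.sum_range_succ]
    exact le_add_of_nonneg_right (Set.indicator_nonneg (fun _ _ => zero_le_one) _)
  · intro a ha
    refine ⟨fun n => (n + 1) ^ 2, ?_, ?_, ?_⟩
    · have h1 : Tendsto (fun n : ℕ => (1 + 1 / ((n : ℝ) + 1)) ^ 2) atTop (𝓝 ((1 + 0) ^ 2)) :=
        (tendsto_const_nhds.add tendsto_one_div_add_atTop_nhds_zero_nat).pow 2
      have h2 := h1.eventually_lt_const (show (1 + 0 : ℝ) ^ 2 < a by simpa using ha)
      filter_upwards [h2] with n hn
      have h3 : (((n + 1 + 1) ^ 2 : ℕ) : ℝ) = (1 + 1 / ((n : ℝ) + 1)) ^ 2 * (((n + 1) ^ 2 : ℕ) : ℝ) := by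
        push_cast
        field_simp
      rw [h3]
      gcongr
    · exact (tendsto_pow_atTop two_ne_zero).comp (tendsto_add_atTop_nat 1)
    · have h1 := hω.sqrt
      simp only [Real.sqrt_sq_eq_abs, Real.sqrt_zero] at h1
      have h2 := (tendsto_zero_iff_abs_tendsto_zero _).2 h1
      simpa using h2.add_const p

/-! ### The canonical model -/

/-- The labels of the gaps and of the waiting times. -/
abbrev Coord (ι : Type*) := ι ⊕ (ι × List ℕ × ℕ)

/-- The rate of the exponential variable with a given label. -/
def rate {ι : Type*} (lamH lamA : ℝ) : Coord ι → ℝ := Sum.elim (fun _ => lamH) fun _ => lamA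

/-- The joint law of all gaps and waiting times. -/
noncomputable def canon (lamH lamA : ℝ) (ι : Type*) : Measure (Coord ι → ℝ) :=
  Measure.infinitePi fun q : Coord ι => expMeasure (rate lamH lamA q)

theorem rate_pos {ι : Type*} {lamH lamA : ℝ} (hH : 0 < lamH) (hA : 0 < lamA) (q : Coord ι) :
    0 < rate lamH lamA q := by
  cases q <;> assumption

section Canon

variable {ι : Type*} {lamH lamA : ℝ}

theorem isProbabilityMeasure_canon (hH : 0 < lamH) (hA : 0 < lamA) :
    IsProbabilityMeasure (canon lamH lamA ι) := by
  have := fun q : Coord ι => isProbabilityMeasure_expMeasure (rate_pos hH hA q)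
  unfold canon
  infer_instance

theorem map_eval_canon (hH : 0 < lamH) (hA : 0 < lamA) (q : Coord ι) :
    (canon lamH lamA ι).map (fun ω => ω q) = expMeasure (rate lamH lamA q) := by
  have := fun q : Coord ι => isProbabilityMeasure_expMeasure (rate_pos hH hA q)
  exact Measure.infinitePi_map_eval _ q

theorem iIndepFun_canon (hH : 0 < lamH) (hA : 0 < lamA) :
    iIndepFun (fun (q : Coord ι) (ω : Coord ι → ℝ) => ω q) (canon lamH lamA ι) := by
  have := fun q : Coord ι => isProbabilityMeasure_expMeasure (rate_pos hH hA q)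
  exact iIndepFun_infinitePi (X := fun _ x => x) fun _ => measurable_id

/-- Used twice: for the shifts of `ℤ`, which gives stationarity, and for the inclusion of `ℕ` in
`ℤ`, which realises the one-sided model inside the two-sided one. -/
theorem map_precomp_canon (hH : 0 < lamH) (hA : 0 < lamA) {κ : Type*} {f : κ → ι}
    (hf : f.Injective) :
    (canon lamH lamA ι).map (fun ω q => ω (Sum.map f (Prod.map f id) q)) = canon lamH lamA κ := by
  have := fun q : Coord ι => isProbabilityMeasure_expMeasure (rate_pos hH hA q)
  have hinj : (Sum.map f (Prod.map f id) : Coord κ → Coord ι).Injective :=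
    hf.sumMap (hf.prodMap Function.injective_id)
  refine (Measure.map_infinitePi_infinitePi_of_inj
    (P := fun q : Coord ι => expMeasure (rate lamH lamA q)) hinj).trans ?_
  unfold canon
  congr 1
  ext1 q
  cases q <;> rfl

theorem ae_pos_canon [Countable ι] (hH : 0 < lamH) (hA : 0 < lamA) :
    ∀ᵐ ω ∂(canon lamH lamA ι), ∀ q, 0 < ω q := by
  refine ae_all_iff.2 fun q => ?_
  have h := ae_pos_expMeasure (rate_pos hH hA q)
  rw [← map_eval_canon hH hA q] at h
  exact ae_of_ae_map (measurable_pi_apply q).aemeasurable h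

/-- The σ-algebra generated by the coordinates in `S`. -/
abbrev coordAlgebra (S : Set (Coord ι)) : MeasurableSpace (Coord ι → ℝ) :=
  ⨆ q ∈ S, MeasurableSpace.comap (fun ω : Coord ι → ℝ => ω q) inferInstance

theorem measurable_coord {S : Set (Coord ι)} {q : Coord ι} (hq : q ∈ S) :
    Measurable[coordAlgebra S] fun ω : Coord ι → ℝ => ω q :=
  measurable_iff_comap_le.2 <| le_iSup₂_of_le q hq le_rfl

theorem measure_inter_of_disjoint (hH : 0 < lamH) (hA : 0 < lamA) {S T : Set (Coord ι)}
    (hST : Disjoint S T) {A B : Set (Coord ι → ℝ)} (hAS : MeasurableSet[coordAlgebra S] A)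
    (hBT : MeasurableSet[coordAlgebra T] B) :
    canon lamH lamA ι (A ∩ B) = canon lamH lamA ι A * canon lamH lamA ι B := by
  have h := indep_iSup_of_disjoint (fun q => (measurable_pi_apply q).comap_le)
    (iIndepFun_canon (ι := ι) hH hA).iIndep hST
  exact (Indep_iff _ _ _).1 h A B hAS hBT

end Canon

/-! ### Adversarial trees that overtake the honest chain -/

/-- The tree rooted at block `i` reaches the depth `m` before the honest chain has been extended by
`m + 1` blocks after block `i`, for the gaps `R` and the waiting times `X`. -/
def Overtakes {ι : Type*} [Add ι] [NatCast ι] (R : ι → ℝ) (X : ι → List ℕ → ℕ → ℝ) (i : ι)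
    (m : ℕ) : Prop :=
  ∃ v : List ℕ, v.length = m ∧ birth (X i) v < ∑ l ∈ Finset.range (m + 1), R (i + l)

/-- `Overtakes` for the canonical model. -/
def Catches {ι : Type*} [Add ι] [NatCast ι] (ω : Coord ι → ℝ) (i : ι) (m : ℕ) : Prop :=
  Overtakes (fun l => ω (.inl l)) (fun k u n => ω (.inr (k, u, n))) i m

theorem birth_mono {X X' : List ℕ → ℕ → ℝ} (h : ∀ u n, X u n ≤ X' u n) (v : List ℕ) :
    birth X v ≤ birth X' v := by
  rw [birth_eq_sum_waits, birth_eq_sum_waits]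
  exact Finset.sum_le_sum fun q _ => h _ _

theorem Overtakes.mono {ι : Type*} [Add ι] [NatCast ι] {R R' : ι → ℝ}
    {X X' : ι → List ℕ → ℕ → ℝ} (hR : ∀ l, R l ≤ R' l) (hX : ∀ k u n, X' k u n ≤ X k u n) {i : ι}
    {m : ℕ} (h : Overtakes R X i m) : Overtakes R' X' i m := by
  obtain ⟨v, hv, hlt⟩ := h
  exact ⟨v, hv, (birth_mono (hX i) v).trans_lt
    (hlt.trans_le (Finset.sum_le_sum fun l _ => hR _))⟩

theorem measurableSet_overtakes {α ι : Type*} [MeasurableSpace α] [Add ι] [NatCast ι]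
    {R : α → ι → ℝ} {X : α → ι → List ℕ → ℕ → ℝ} {i : ι} {m : ℕ}
    (hR : ∀ l : ℕ, l ≤ m → Measurable fun a => R a (i + l))
    (hX : ∀ u n, Measurable fun a => X a i u n) :
    MeasurableSet {a | Overtakes (R a) (X a) i m} := by
  have h : {a | Overtakes (R a) (X a) i m} = ⋃ (v : List ℕ) (_ : v.length = m),
      {a | ∑ q ∈ waits v, X a i q.1 q.2 < ∑ l ∈ Finset.range (m + 1), R a (i + l)} := by
    ext a
    simp [Overtakes, birth_eq_sum_waits]
  rw [h]
  refine MeasurableSet.iUnion fun v => MeasurableSet.iUnion fun _ => measurableSet_lt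
    (Finset.measurable_sum _ fun q _ => hX _ _) (Finset.measurable_sum _ fun l hl => hR l ?_)
  exact Nat.lt_succ_iff.1 (Finset.mem_range.1 hl)

/-- The threshold `c * m` separates the slow tree from the slow honest chain. The Chernoff
parameters `c⁻¹` and `lamH - c⁻¹` minimise the two exponential rates; the prefactor `lamH * c` comes
from the extra gap among the `m + 1`. -/
theorem measure_catches_le {lamH lamA : ℝ} (hH : 0 < lamH) (hA : 0 < lamA) {c : ℝ}
    (hc : 1 < lamH * c) (i : ℤ) (m : ℕ) :
    canon lamH lamA ℤ {ω | Catches ω i m} ≤ ENNReal.ofReal ((Real.exp 1 * c * lamA) ^ m)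
      + ENNReal.ofReal (lamH * c * (lamH * c * Real.exp (1 - lamH * c)) ^ m) := by
  have hc0 : 0 < c := by
    by_contra h
    nlinarith
  have hsub : {ω : Coord ℤ → ℝ | Catches ω i m}
      ⊆ {ω | ∃ v : List ℕ, v.length = m ∧ birth (fun u n => ω (.inr (i, u, n))) v ≤ c * m}
        ∪ {ω | c * m ≤ (∑ l ∈ Finset.range (m + 1),
          fun ω : Coord ℤ → ℝ => ω (.inl (i + l))) ω} := by
    rintro ω ⟨v, hv, hlt⟩
    rcases le_or_gt (birth (fun u n => ω (.inr (i, u, n))) v) (c * m) with h | h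
    · exact Or.inl ⟨v, hv, h⟩
    · refine Or.inr ?_
      rw [Set.mem_ofPred_eq, Finset.sum_apply]
      exact (h.trans hlt).le
  have h1 := measure_exists_birth_le hA (fun q => measurable_pi_apply q)
    (iIndepFun_canon (ι := ℤ) hH hA) (fun q => .inr (i, q))
    (fun a b h => by simpa using h) (fun q => map_eval_canon hH hA _) (inv_pos.2 hc0) (c * m) m
  have hinj : (fun l : ℕ => (Sum.inl (i + l) : Coord ℤ)).Injective := fun a b h => by
    simpa using h
  have h2 := measure_le_sum_exp hH (fun l : ℕ => measurable_pi_apply _)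
    ((iIndepFun_canon (ι := ℤ) hH hA).precomp hinj) (s := Finset.range (m + 1))
    (fun l _ => map_eval_canon hH hA _) (t := lamH - c⁻¹)
    (sub_nonneg.2 (by rw [inv_le_iff_one_le_mul₀ hc0]; exact hc.le))
    (sub_lt_self _ (inv_pos.2 hc0)) (c * m)
  have := isProbabilityMeasure_canon (ι := ℤ) hH hA
  refine (measure_mono hsub).trans ((measure_union_le _ _).trans (add_le_add ?_ ?_))
  · refine h1.trans (ENNReal.ofReal_le_ofReal (le_of_eq ?_))
    rw [← mul_assoc, inv_mul_cancel₀ hc0.ne', one_mul, mul_assoc, mul_pow, div_inv_eq_mul,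
      ← Real.exp_nat_mul, mul_one, mul_comm lamA]
  · rw [← ofReal_measureReal]
    refine ENNReal.ofReal_le_ofReal (h2.trans (le_of_eq ?_))
    have : -(lamH - c⁻¹) * (c * m) = m * (1 - lamH * c) := by
      field_simp
      ring
    rw [sub_sub_cancel, div_inv_eq_mul, Finset.card_range, this, Real.exp_nat_mul]
    ring

theorem exists_measure_catches_le {lamH lamA : ℝ} (hA : 0 < lamA)
    (hlt : lamA * Real.exp 1 < lamH) :
    ∃ C ρ : ℝ, 0 ≤ C ∧ 0 ≤ ρ ∧ ρ < 1 ∧ ∀ (i : ℤ) (m : ℕ),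
      canon lamH lamA ℤ {ω | Catches ω i m} ≤ ENNReal.ofReal (C * ρ ^ m) := by
  have he := Real.exp_pos 1
  have hH : 0 < lamH := lt_trans (by positivity) hlt
  -- The only use of the rate condition: it makes room for `1 / lamH < c < 1 / (lamA * e)`.
  obtain ⟨c, hc1, hc2⟩ := exists_between ((one_div_lt_one_div hH (by positivity)).2 hlt)
  rw [div_lt_iff₀ hH, mul_comm] at hc1
  rw [lt_div_iff₀ (by positivity)] at hc2
  have hc0 : 0 < c := by
    by_contra h
    nlinarith
  set ρ₁ := Real.exp 1 * c * lamA
  set ρ₂ := lamH * c * Real.exp (1 - lamH * c)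
  have hρ₁ : ρ₁ < 1 := by
    simp only [ρ₁]
    linarith
  have hρ₂ : ρ₂ < 1 := by
    -- This is `u * exp (1 - u) < 1` for `u = lamH * c ≠ 1`.
    have h1 := Real.add_one_lt_exp (x := lamH * c - 1) (by linarith)
    calc ρ₂ < Real.exp (lamH * c - 1) * Real.exp (1 - lamH * c) := by
          simp only [ρ₂]
          gcongr
          linarith
      _ = 1 := by rw [← Real.exp_add]; simp
  have h₁ : 0 ≤ ρ₁ := by positivity
  have h₂ : 0 ≤ ρ₂ := by positivity
  refine ⟨1 + lamH * c, max ρ₁ ρ₂, by positivity, h₁.trans (le_max_left _ _), max_lt hρ₁ hρ₂,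
    fun i m => (measure_catches_le hH hA hc1 i m).trans ?_⟩
  rw [← ENNReal.ofReal_add (by positivity) (by positivity)]
  refine ENNReal.ofReal_le_ofReal ?_
  have h3 : ρ₁ ^ m ≤ max ρ₁ ρ₂ ^ m := pow_le_pow_left₀ h₁ (le_max_left _ _) m
  have h4 : ρ₂ ^ m ≤ max ρ₁ ρ₂ ^ m := pow_le_pow_left₀ h₂ (le_max_right _ _) m
  rw [add_mul, one_mul]
  gcongr

/-! ### Convergence events in the canonical model -/

/-- For `(a, b) ∈ K`, the tree rooted at the `(a + 1)`-st block before block `j` does not catch up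
between the blocks `j + b` and `j + b + 1`. -/
def good (K : Set (ℕ × ℕ)) (j : ℤ) : Set (Coord ℤ → ℝ) :=
  {ω | ∀ a b : ℕ, (a, b) ∈ K → ¬ Catches ω (j - 1 - a) (a + b + 1)}

theorem good_anti {K K' : Set (ℕ × ℕ)} (h : K ⊆ K') (j : ℤ) : good K' j ⊆ good K j :=
  fun _ hω a b hab => hω a b (h hab)

/-- The labels of the gaps and waiting times that belong to the blocks in `s`. -/
def coordsOf (s : Set ℤ) : Set (Coord ℤ) := Sum.inl '' s ∪ {q | ∃ x, q = Sum.inr x ∧ x.1 ∈ s}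

theorem disjoint_coordsOf {s t : Set ℤ} (h : Disjoint s t) :
    Disjoint (coordsOf s) (coordsOf t) := by
  rw [Set.disjoint_left] at h ⊢
  rintro q (⟨l, hl, rfl⟩ | ⟨x, rfl, hx⟩) (⟨l', hl', h'⟩ | ⟨x', h', hx'⟩)
  · simp only [Sum.inl.injEq] at h'
    exact h hl (h' ▸ hl')
  · simp at h'
  · simp at h'
  · simp only [Sum.inr.injEq] at h'
    exact h hx (h' ▸ hx')

theorem measurableSet_catches {mΩ : MeasurableSpace (Coord ℤ → ℝ)} {i : ℤ} {m : ℕ}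
    (hR : ∀ l : ℕ, l ≤ m → Measurable[mΩ] fun ω : Coord ℤ → ℝ => ω (.inl (i + l)))
    (hX : ∀ u n, Measurable[mΩ] fun ω : Coord ℤ → ℝ => ω (.inr (i, u, n))) :
    MeasurableSet[mΩ] {ω : Coord ℤ → ℝ | Catches ω i m} :=
  measurableSet_overtakes (R := fun (ω : Coord ℤ → ℝ) l => ω (.inl l))
    (X := fun (ω : Coord ℤ → ℝ) k u n => ω (.inr (k, u, n))) hR hX

theorem measurableSet_good (K : Set (ℕ × ℕ)) (j : ℤ) : MeasurableSet (good K j) := by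
  have h : good K j = ⋂ (a : ℕ) (b : ℕ) (_ : (a, b) ∈ K),
      {ω | Catches ω (j - 1 - a) (a + b + 1)}ᶜ := by
    ext
    simp [good]
  rw [h]
  exact MeasurableSet.iInter fun a => MeasurableSet.iInter fun b => MeasurableSet.iInter fun _ =>
    (measurableSet_catches (fun l _ => measurable_pi_apply _)
      fun u n => measurable_pi_apply _).compl

/-- For `a, b < L` the root `j - 1 - a` is at least `j - L`, and the last gap used has index `j + b
< j + L`. Hence boxes around centres at distance at least `2 * L` use disjoint sets of coordinates.
-/
theorem measurableSet_good_box (L : ℕ) (j : ℤ) :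
    MeasurableSet[coordAlgebra (coordsOf (Set.Ico (j - L) (j + L)))]
      (good (Set.Iio L ×ˢ Set.Iio L) j) := by
  have h : good (Set.Iio L ×ˢ Set.Iio L) j = ⋂ (a : ℕ) (b : ℕ) (_ : a < L ∧ b < L),
      {ω | Catches ω (j - 1 - a) (a + b + 1)}ᶜ := by
    ext
    simp only [good, Set.mem_prod, Set.mem_Iio, Set.mem_ofPred_eq, Set.mem_iInter,
      Set.mem_compl_iff]
  rw [h]
  let mΩ := coordAlgebra (coordsOf (Set.Ico (j - (L : ℤ)) (j + L)))
  refine MeasurableSet.iInter fun a => MeasurableSet.iInter fun b => MeasurableSet.iInter fun hab =>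
    (measurableSet_catches (mΩ := mΩ) (fun l hl => measurable_coord (Or.inl ⟨_, ?_, rfl⟩))
      fun u n => measurable_coord (Or.inr ⟨_, rfl, ?_⟩)).compl
  · simp only [Set.mem_Ico]
    omega
  · simp only [Set.mem_Ico]
    omega

theorem measure_iUnion_ge_le {Ω : Type*} [MeasurableSpace Ω] {P : Measure Ω}
    {B : ℕ → ℕ → Set Ω} {C ρ : ℝ} (hC : 0 ≤ C) (h0 : 0 ≤ ρ) (h1 : ρ < 1)
    (hB : ∀ a b, P (B a b) ≤ ENNReal.ofReal (C * ρ ^ (a + b))) (L : ℕ) :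
    P (⋃ (a : ℕ) (b : ℕ), B (L + a) b) ≤ ENNReal.ofReal (C / (1 - ρ) ^ 2 * ρ ^ L) := by
  have hg := summable_geometric_of_lt_one h0 h1
  have h2 : ∀ a b, ENNReal.ofReal (C * ρ ^ (L + a + b))
      = ENNReal.ofReal (C * ρ ^ L) * (ENNReal.ofReal (ρ ^ a) * ENNReal.ofReal (ρ ^ b)) := by
    intro a b
    rw [← ENNReal.ofReal_mul (by positivity), ← ENNReal.ofReal_mul (by positivity)]
    congr 1
    ring
  calc _ ≤ ∑' a, ∑' b, P (B (L + a) b) :=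
        (measure_iUnion_le _).trans (ENNReal.tsum_le_tsum fun a => measure_iUnion_le _)
    _ ≤ ∑' a, ∑' b, ENNReal.ofReal (C * ρ ^ (L + a + b)) :=
        ENNReal.tsum_le_tsum fun a => ENNReal.tsum_le_tsum fun b => hB _ _
    _ = _ := by
      simp_rw [h2, ENNReal.tsum_mul_left, ENNReal.tsum_mul_right,
        ← ENNReal.ofReal_tsum_of_nonneg (fun n => pow_nonneg h0 n) hg, tsum_geometric_of_lt_one h0 h1]
      have := sub_pos.2 h1
      rw [← ENNReal.ofReal_mul (by positivity), ← ENNReal.ofReal_mul (by positivity)]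
      congr 1
      field_simp

section

variable {lamH lamA : ℝ}

theorem exists_measure_compl_good_le (hA : 0 < lamA) (hlt : lamA * Real.exp 1 < lamH) :
    ∃ D ρ : ℝ, 0 ≤ D ∧ 0 ≤ ρ ∧ ρ < 1 ∧ ∀ (j : ℤ) (L : ℕ),
      canon lamH lamA ℤ (good {x | L ≤ x.1 ∨ L ≤ x.2} j)ᶜ ≤ ENNReal.ofReal (D * ρ ^ L) := by
  obtain ⟨C, ρ, hC, h0, h1, hb⟩ := exists_measure_catches_le hA hlt
  have := sub_pos.2 h1
  refine ⟨C * ρ / (1 - ρ) ^ 2 + C * ρ / (1 - ρ) ^ 2, ρ, by positivity, h0, h1, fun j L => ?_⟩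
  -- The depth to be reached is `m = a + b + 1`, so the bound is doubly geometric and summable over
  -- pairs.
  have hB : ∀ a b : ℕ, canon lamH lamA ℤ {ω | Catches ω (j - 1 - a) (a + b + 1)}
      ≤ ENNReal.ofReal (C * ρ * ρ ^ (a + b)) := by
    intro a b
    refine (hb _ _).trans (le_of_eq ?_)
    ring_nf
  have hB' : ∀ b a : ℕ, canon lamH lamA ℤ {ω | Catches ω (j - 1 - a) (a + b + 1)}
      ≤ ENNReal.ofReal (C * ρ * ρ ^ (b + a)) := by
    intro b a
    rw [add_comm b a]
    exact hB a b
  have hsub : (good {x | L ≤ x.1 ∨ L ≤ x.2} j)ᶜ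
      ⊆ (⋃ (a : ℕ) (b : ℕ), {ω | Catches ω (j - 1 - (L + a : ℕ)) (L + a + b + 1)})
        ∪ ⋃ (b : ℕ) (a : ℕ), {ω | Catches ω (j - 1 - a) (a + (L + b) + 1)} := by
    intro ω hω
    simp only [good, Set.mem_compl_iff, Set.mem_ofPred_eq, not_forall, not_not] at hω
    obtain ⟨a, b, hab, h⟩ := hω
    rcases hab with hab | hab
    · obtain ⟨a, rfl⟩ := Nat.exists_eq_add_of_le hab
      exact Or.inl (Set.mem_iUnion₂.2 ⟨a, b, h⟩)
    · obtain ⟨b, rfl⟩ := Nat.exists_eq_add_of_le hab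
      exact Or.inr (Set.mem_iUnion₂.2 ⟨b, a, h⟩)
  refine (measure_mono hsub).trans ((measure_union_le _ _).trans ?_)
  rw [add_mul, ENNReal.ofReal_add (by positivity) (by positivity)]
  exact add_le_add (measure_iUnion_ge_le (by positivity) h0 h1 hB L)
    (measure_iUnion_ge_le (by positivity) h0 h1 hB' L)

theorem measure_good_eq (hH : 0 < lamH) (hA : 0 < lamA) (K : Set (ℕ × ℕ)) (j : ℤ) :
    canon lamH lamA ℤ (good K j) = canon lamH lamA ℤ (good K 0) := by
  have h := map_precomp_canon (lamH := lamH) (lamA := lamA) (f := fun l : ℤ => j + l) hH hA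
    (add_right_injective j)
  conv_rhs => rw [← h]
  rw [Measure.map_apply (measurable_pi_lambda _ fun q => measurable_pi_apply _)
    (measurableSet_good K 0)]
  congr 1
  ext ω
  simp only [good, Catches, Overtakes, Set.mem_preimage, Set.mem_ofPred_eq, Sum.map_inl,
    Sum.map_inr, Prod.map_apply, id_eq, zero_sub]
  have h1 : ∀ a : ℕ, j + (-1 - (a : ℤ)) = j - 1 - a := fun a => by ring
  have h2 : ∀ a l : ℕ, j + (-1 - (a : ℤ) + l) = j - 1 - a + l := fun a l => by ring
  simp only [h1, h2]

theorem measure_good_box_inter (hH : 0 < lamH) (hA : 0 < lamA) {i j : ℤ} {L : ℕ}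
    (hij : 2 * L ≤ (i - j).natAbs) :
    canon lamH lamA ℤ (good (Set.Iio L ×ˢ Set.Iio L) i ∩ good (Set.Iio L ×ˢ Set.Iio L) j)
      = canon lamH lamA ℤ (good (Set.Iio L ×ˢ Set.Iio L) i)
        * canon lamH lamA ℤ (good (Set.Iio L ×ˢ Set.Iio L) j) := by
  refine measure_inter_of_disjoint hH hA (disjoint_coordsOf ?_) (measurableSet_good_box L i)
    (measurableSet_good_box L j)
  rw [Set.disjoint_left]
  intro x hx hy
  simp only [Set.mem_Ico] at hx hy
  omega

/-! ### Positivity -/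

/-- The first waiting times and the gaps of the blocks at distance at most `L` from block `0`. -/
noncomputable def nearCoords (L : ℕ) : Finset (Coord ℤ) :=
  (Finset.Ico (-(L : ℤ)) L).image Sum.inl
    ∪ (Finset.Ico (-(L : ℤ)) L).image fun l => Sum.inr (l, [], 0)

/-- The configuration whose near gaps are `1 / x` and whose near first waiting times are `x`. -/
noncomputable def reset (L : ℕ) (x : ℝ) (ω : Coord ℤ → ℝ) : Coord ℤ → ℝ := fun q =>
  if q ∈ nearCoords L then Sum.elim (fun _ => 1 / x) (fun _ => x) q else ω q

/-- The values that are at least as good for the honest chain as those of `reset`. -/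
noncomputable def better (x : ℝ) : Coord ℤ → Set ℝ :=
  Sum.elim (fun _ => Set.Iic (1 / x)) fun _ => Set.Ioi x

theorem mem_good_of_le {K : Set (ℕ × ℕ)} {j : ℤ} {ω ω' : Coord ℤ → ℝ} (hω : ω ∈ good K j)
    (hR : ∀ l, ω' (.inl l) ≤ ω (.inl l)) (hX : ∀ x, ω (.inr x) ≤ ω' (.inr x)) :
    ω' ∈ good K j :=
  fun a b hab h => hω a b hab (h.mono hR fun _ _ _ => hX _)

/-- After the reset nothing depends on the near coordinates any more; this yields independence from
any condition imposed on them. -/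
theorem measurable_reset (L : ℕ) (x : ℝ) :
    Measurable[coordAlgebra (↑(nearCoords L))ᶜ] (reset L x) := by
  let _ := coordAlgebra ((↑(nearCoords L) : Set (Coord ℤ))ᶜ)
  refine measurable_pi_lambda _ fun q => ?_
  by_cases hq : q ∈ nearCoords L
  · simp only [reset, hq, if_true]
    exact measurable_const
  · simp only [reset, hq, if_false]
    exact measurable_coord (by simpa using hq)

theorem measurableSet_better (x : ℝ) (q : Coord ℤ) : MeasurableSet (better x q) := by
  cases q
  · exact measurableSet_Iic
  · exact measurableSet_Ioi

theorem measurableSet_pi_better (L : ℕ) (x : ℝ) :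
    MeasurableSet[coordAlgebra ↑(nearCoords L)] (Set.pi ↑(nearCoords L) (better x)) := by
  let _ := coordAlgebra (↑(nearCoords L) : Set (Coord ℤ))
  rw [Set.pi_def]
  exact Finset.measurableSet_biInter _ fun q hq => measurable_coord hq (measurableSet_better x q)

theorem measure_pi_better_pos (hH : 0 < lamH) (hA : 0 < lamA) (L : ℕ) {x : ℝ} (hx : 0 < x) :
    0 < canon lamH lamA ℤ (Set.pi ↑(nearCoords L) (better x)) := by
  have := fun q : Coord ℤ => isProbabilityMeasure_expMeasure (rate_pos hH hA q)
  rw [canon, Measure.infinitePi_pi _ fun q _ => measurableSet_better x q, pos_iff_ne_zero,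
    Finset.prod_ne_zero_iff]
  rintro (l | y) -
  · exact (expMeasure_Iic_pos hH (one_div_pos.2 hx)).ne'
  · exact (expMeasure_Ioi_pos hA hx.le).ne'

/-- For positive `ω` and large `M`, the reset shortens the near gaps and lengthens the near first
waiting times, which can only help the honest chain. So almost every point of `good K 0` lies in one
of countably many reset events. -/
theorem exists_measure_reset_pos (hH : 0 < lamH) (hA : 0 < lamA) (L : ℕ) {K : Set (ℕ × ℕ)}
    (hK : canon lamH lamA ℤ (good K 0) ≠ 0) :
    ∃ M : ℕ, canon lamH lamA ℤ (reset L (M + 1) ⁻¹' good K 0) ≠ 0 := by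
  by_contra! h
  refine hK (measure_mono_null_ae ?_ (measure_iUnion_null h))
  filter_upwards [ae_pos_canon (ι := ℤ) hH hA] with ω hpos hω
  have hev : ∀ q ∈ nearCoords L, ∀ᶠ M : ℕ in atTop, 1 / ((M : ℝ) + 1) ≤ ω q ∧ ω q ≤ M + 1 := by
    intro q _
    have h1 := (tendsto_one_div_add_atTop_nhds_zero_nat (𝕜 := ℝ)).eventually_lt_const (hpos q)
    filter_upwards [h1, eventually_ge_atTop ⌈ω q⌉₊] with M h2 h3
    exact ⟨h2.le, (Nat.ceil_le.1 h3).trans (by linarith)⟩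
  obtain ⟨M, hM⟩ := ((nearCoords L).eventually_all.2 hev).exists
  refine Set.mem_iUnion.2 ⟨M, mem_good_of_le hω (fun l => ?_) fun y => ?_⟩
  · by_cases hq : Sum.inl l ∈ nearCoords L
    · simpa [reset, hq] using (hM _ hq).1
    · simp [reset, hq]
  · by_cases hq : Sum.inr y ∈ nearCoords L
    · simpa [reset, hq] using (hM _ hq).2
    · simp [reset, hq]

theorem birth_ge_first {X : List ℕ → ℕ → ℝ} (hX : ∀ u n, 0 ≤ X u n) {v : List ℕ} (hv : v ≠ []) :
    X [] 0 ≤ birth X v := by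
  rw [birth_eq_sum_waits]
  refine Finset.single_le_sum (f := fun q : List ℕ × ℕ => X q.1 q.2) (fun q _ => hX _ _)
    (a := ([], 0)) ?_
  induction v with
  | nil => exact absurd rfl hv
  | cons n u ih =>
    rw [waits, Finset.mem_union]
    by_cases hu : u = []
    · subst hu
      exact Or.inr (Finset.mem_map.2 ⟨0, by simp, rfl⟩)
    · exact Or.inl (ih hu)

/-- Far pairs are handled by comparison with the reset configuration, since `x ≤ y`. For near pairs
every non-root block is born after time `y ≥ 1`, whereas the at most `2 * L` gaps involved, each at
most `1 / y`, add up to at most `1`. -/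
theorem mem_good_univ_of_better {L : ℕ} {x y : ℝ} (hx : 0 < x) (hxy : x + 2 * L ≤ y)
    (hy : 1 ≤ y) {ω : Coord ℤ → ℝ} (hpos : ∀ q, 0 < ω q)
    (hr : reset L x ω ∈ good {z | L ≤ z.1 ∨ L ≤ z.2} 0)
    (hb : ω ∈ Set.pi ↑(nearCoords L) (better y)) : ω ∈ good Set.univ 0 := by
  have hinl : ∀ l ∈ Finset.Ico (-(L : ℤ)) L, ω (.inl l) ≤ 1 / y := by
    intro l hl
    exact hb (.inl l) (Finset.mem_coe.2 (Finset.mem_union_left _ (Finset.mem_image_of_mem _ hl)))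
  have hinr : ∀ l ∈ Finset.Ico (-(L : ℤ)) L, y < ω (.inr (l, [], 0)) := by
    intro l hl
    exact hb (.inr (l, [], 0)) (Finset.mem_coe.2 (Finset.mem_union_right _
      (Finset.mem_image_of_mem (fun l => Sum.inr (l, [], 0)) hl)))
  have hxy' : x ≤ y := by
    have : (0 : ℝ) ≤ 2 * L := by positivity
    linarith
  have hfar : ω ∈ good {z | L ≤ z.1 ∨ L ≤ z.2} 0 := by
    refine mem_good_of_le hr (fun l => ?_) fun z => ?_
    · by_cases hq : Sum.inl l ∈ nearCoords L
      · have h1 : ω (.inl l) ≤ 1 / y := hb _ hq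
        have h2 := one_div_le_one_div_of_le hx hxy'
        simpa [reset, hq] using h1.trans h2
      · simp [reset, hq]
    · by_cases hq : Sum.inr z ∈ nearCoords L
      · have h1 : y < ω (.inr z) := hb _ hq
        simpa [reset, hq] using hxy'.trans h1.le
      · simp [reset, hq]
  intro a b _
  by_cases hab : L ≤ a ∨ L ≤ b
  · exact hfar a b hab
  rintro ⟨v, hv, hlt⟩
  push Not at hab
  have h1 : ω (.inr (0 - 1 - (a : ℤ), [], 0)) ≤ _ :=
    birth_ge_first (X := fun u n => ω (.inr (0 - 1 - (a : ℤ), u, n))) (fun u n => (hpos _).le)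
      (v := v) (by rintro rfl; simp at hv)
  have h2 := hinr (0 - 1 - (a : ℤ)) (by rw [Finset.mem_Ico]; omega)
  have h3 : ∑ l ∈ Finset.range (a + b + 1 + 1), ω (.inl (0 - 1 - (a : ℤ) + l)) ≤ 1 := by
    calc _ ≤ ∑ l ∈ Finset.range (a + b + 1 + 1), 1 / y := by
          refine Finset.sum_le_sum fun l hl => hinl _ ?_
          rw [Finset.mem_range] at hl
          rw [Finset.mem_Ico]
          omega
      _ = ((a + b + 1 + 1 : ℕ) : ℝ) / y := by simp [div_eq_mul_inv]
      _ ≤ 1 := by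
        rw [div_le_one (by linarith)]
        have : ((a + b + 1 + 1 : ℕ) : ℝ) ≤ ((2 * L : ℕ) : ℝ) := by
          exact_mod_cast (by omega : a + b + 1 + 1 ≤ 2 * L)
        push_cast at this ⊢
        linarith
  linarith

theorem measure_good_univ_pos (hA : 0 < lamA) (hlt : lamA * Real.exp 1 < lamH) :
    canon lamH lamA ℤ (good Set.univ 0) ≠ 0 := by
  have hH : 0 < lamH := lt_trans (by positivity) hlt
  have := isProbabilityMeasure_canon (ι := ℤ) hH hA
  obtain ⟨D, ρ, hD, h0, h1, hb⟩ := exists_measure_compl_good_le hA hlt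
  obtain ⟨L, hL⟩ : ∃ L : ℕ, D * ρ ^ L < 1 := by
    have h2 := (tendsto_pow_atTop_nhds_zero_of_lt_one h0 h1).const_mul D
    rw [mul_zero] at h2
    exact (h2.eventually_lt_const one_pos).exists
  have hK : canon lamH lamA ℤ (good {z | L ≤ z.1 ∨ L ≤ z.2} 0) ≠ 0 := by
    intro h
    have h2 := hb 0 L
    rw [(prob_compl_eq_one_iff (measurableSet_good _ _)).2 h, ENNReal.one_le_ofReal] at h2
    linarith
  obtain ⟨M, hM⟩ := exists_measure_reset_pos hH hA L hK
  have hx : (0 : ℝ) < M + 1 := by positivity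
  set y : ℝ := M + 1 + 2 * L with hy
  have hy1 : 1 ≤ y := by
    have h3 : (0 : ℝ) ≤ M := by positivity
    have h4 : (0 : ℝ) ≤ 2 * L := by positivity
    linarith
  -- The reset event lives off the near coordinates and `better` lives on them, so the probabilities
  -- multiply and both factors are nonzero.
  have hind := measure_inter_of_disjoint (ι := ℤ) hH hA disjoint_compl_left
    (measurable_reset L (M + 1) (measurableSet_good {z | L ≤ z.1 ∨ L ≤ z.2} 0))
    (measurableSet_pi_better L y)
  intro hzero
  have h5 : canon lamH lamA ℤ (reset L (M + 1) ⁻¹' good {z | L ≤ z.1 ∨ L ≤ z.2} 0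
      ∩ Set.pi ↑(nearCoords L) (better y)) = 0 := by
    refine measure_mono_null_ae ?_ hzero
    filter_upwards [ae_pos_canon (ι := ℤ) hH hA] with ω hpos hω
    exact mem_good_univ_of_better hx hy.ge hy1 hpos hω.1 hω.2
  rw [hind] at h5
  exact mul_ne_zero hM (measure_pi_better_pos hH hA L (one_pos.trans_le hy1)).ne' h5

end

/-! ### The frequency of the convergence events in the canonical model -/

theorem summable_pow_half {ρ : ℝ} (h0 : 0 ≤ ρ) (h1 : ρ < 1) :
    Summable fun d : ℕ => ρ ^ (d / 2) := by
  have hg := (summable_geometric_of_lt_one h0 h1).hasSum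
  refine (HasSum.even_add_odd (f := fun d : ℕ => ρ ^ (d / 2)) (m := ∑' n, ρ ^ n)
    (m' := ∑' n, ρ ^ n) ?_ ?_).summable
  · simpa using hg
  · have h : ∀ k : ℕ, (2 * k + 1) / 2 = k := fun k => by omega
    simpa [h] using hg

section

variable {lamH lamA : ℝ}

theorem good_box_subset (L : ℕ) (j : ℤ) : good (Set.Iio L ×ˢ Set.Iio L) j
    ⊆ good Set.univ j ∪ (good {x | L ≤ x.1 ∨ L ≤ x.2} j)ᶜ := by
  intro ω hω
  by_cases h : ω ∈ good {x | L ≤ x.1 ∨ L ≤ x.2} j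
  · refine Or.inl fun a b _ => ?_
    by_cases hab : L ≤ a ∨ L ≤ b
    · exact h a b hab
    · push Not at hab
      exact hω a b hab
  · exact Or.inr h

theorem ae_tendsto_frequency_good (hA : 0 < lamA) (hlt : lamA * Real.exp 1 < lamH) :
    ∀ᵐ ω ∂(canon lamH lamA ℤ), Tendsto (frequency (fun j : ℕ => good Set.univ (j : ℤ)) ω) atTop
      (𝓝 ((canon lamH lamA ℤ).real (good Set.univ 0))) := by
  have hH : 0 < lamH := lt_trans (by positivity) hlt
  have := isProbabilityMeasure_canon (ι := ℤ) hH hA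
  obtain ⟨D, ρ, hD, h0, h1, hb⟩ := exists_measure_compl_good_le hA hlt
  set μ := canon lamH lamA ℤ
  have hbr : ∀ (j : ℤ) (L : ℕ), μ.real (good {x | L ≤ x.1 ∨ L ≤ x.2} j)ᶜ ≤ D * ρ ^ L :=
    fun j L => ENNReal.toReal_le_of_le_ofReal (by positivity) (hb j L)
  have hstat : ∀ K (j : ℤ), μ.real (good K j) = μ.real (good K 0) := fun K j => by
    rw [measureReal_def, measure_good_eq hH hA, measureReal_def]
  refine ae_tendsto_frequency (fun j => measurableSet_good _ _) (fun j => hstat _ _)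
    -- With `L` half the distance the box events are independent. If `q` is their probability, then
    -- `p ≤ q ≤ p + D * ρ ^ L` and `q ≤ 1`, so `q ^ 2 - p ^ 2 ≤ 2 * D * ρ ^ L`.
    (e := fun d => 2 * D * ρ ^ (d / 2)) (fun d => by positivity)
    ((summable_pow_half h0 h1).mul_left _) fun i j => ?_
  set L := ((i : ℤ) - j).natAbs / 2
  have hbox : μ.real (good (Set.Iio L ×ˢ Set.Iio L) 0)
      ≤ μ.real (good Set.univ 0) + D * ρ ^ L :=
    (measureReal_mono (good_box_subset L 0)).trans
      ((measureReal_union_le _ _).trans (by gcongr; exact hbr 0 L))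
  have hge : μ.real (good Set.univ 0) ≤ μ.real (good (Set.Iio L ×ˢ Set.Iio L) 0) :=
    measureReal_mono (good_anti (Set.subset_univ _) 0)
  have hinter : μ.real (good Set.univ (i : ℤ) ∩ good Set.univ (j : ℤ))
      ≤ μ.real (good (Set.Iio L ×ˢ Set.Iio L) 0) * μ.real (good (Set.Iio L ×ˢ Set.Iio L) 0) := by
    have hsub := Set.inter_subset_inter
      (good_anti (Set.subset_univ (Set.Iio L ×ˢ Set.Iio L)) (i : ℤ))
      (good_anti (Set.subset_univ (Set.Iio L ×ˢ Set.Iio L)) (j : ℤ))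
    refine (measureReal_mono hsub).trans (le_of_eq ?_)
    rw [measureReal_def, measure_good_box_inter hH hA (Nat.mul_div_le _ 2), ENNReal.toReal_mul,
      ← measureReal_def, ← measureReal_def, hstat _ (i : ℤ), hstat _ (j : ℤ)]
  have hle1 : μ.real (good (Set.Iio L ×ˢ Set.Iio L) 0) ≤ 1 := measureReal_le_one
  have hp0 : 0 ≤ μ.real (good Set.univ 0) := measureReal_nonneg
  have hε : 0 ≤ D * ρ ^ L := by positivity
  nlinarith

/-- Borel–Cantelli with cutoff `L = j`: the pairs with `a ≥ j` are exactly the trees rooted at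
negative blocks. -/
theorem ae_eventually_good_iff (hA : 0 < lamA) (hlt : lamA * Real.exp 1 < lamH) :
    ∀ᵐ ω ∂(canon lamH lamA ℤ), ∀ᶠ j : ℕ in atTop,
      (ω ∈ good Set.univ (j : ℤ) ↔ ω ∈ good {x | x.1 < j} (j : ℤ)) := by
  obtain ⟨D, ρ, hD, h0, h1, hb⟩ := exists_measure_compl_good_le hA hlt
  have hsum : ∑' j : ℕ, canon lamH lamA ℤ (good {x | j ≤ x.1 ∨ j ≤ x.2} (j : ℤ))ᶜ ≠ ⊤ :=
    ne_top_of_le_ne_top ((summable_geometric_of_lt_one h0 h1).mul_left D).tsum_ofReal_ne_top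
      (ENNReal.tsum_le_tsum fun j => hb j j)
  filter_upwards [ae_eventually_notMem hsum] with ω hω
  filter_upwards [hω] with j hj
  rw [Set.notMem_compl_iff] at hj
  refine ⟨fun h => good_anti (Set.subset_univ _) _ h, fun h a b _ => ?_⟩
  rcases lt_or_ge a j with hab | hab
  · exact h a b hab
  · exact hj a b (Or.inl hab)

end

theorem tendsto_frequency_congr {Ω Ω' : Type*} {A : ℕ → Set Ω} {B : ℕ → Set Ω'} {ω : Ω} {ω' : Ω'}
    {p : ℝ} (h : ∀ᶠ j in atTop, (ω ∈ A j ↔ ω' ∈ B j))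
    (hA : Tendsto (frequency A ω) atTop (𝓝 p)) : Tendsto (frequency B ω') atTop (𝓝 p) := by
  obtain ⟨N, hN⟩ := eventually_atTop.1 h
  have hdiff : Tendsto (fun n : ℕ => (∑ j ∈ Finset.range N,
      ((B j).indicator (fun _ => (1 : ℝ)) ω' - (A j).indicator (fun _ => (1 : ℝ)) ω)) / (n : ℝ))
      atTop (𝓝 0) := tendsto_const_div_atTop_nhds_zero_nat _
  have h2 := hA.add hdiff
  rw [add_zero] at h2
  refine h2.congr' ?_
  filter_upwards [eventually_ge_atTop N] with n hn
  have h3 : ∑ j ∈ Finset.range N,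
      ((B j).indicator (fun _ => (1 : ℝ)) ω' - (A j).indicator (fun _ => (1 : ℝ)) ω)
      = ∑ j ∈ Finset.range n,
        ((B j).indicator (fun _ => (1 : ℝ)) ω' - (A j).indicator (fun _ => (1 : ℝ)) ω) := by
    refine Finset.sum_subset (Finset.range_subset_range.2 hn) fun j _ hj => ?_
    have h4 := hN j (not_lt.1 fun h => hj (Finset.mem_range.2 h))
    by_cases h5 : ω ∈ A j
    · simp [h5, h4.1 h5]
    · simp [h5, mt h4.2 h5]
  rw [frequency_eq, frequency_eq, h3, ← add_div, Finset.sum_sub_distrib, add_sub_cancel]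

theorem infinite_of_tendsto_frequency {Ω : Type*} {A : ℕ → Set Ω} {ω : Ω} {p : ℝ} (hp : 0 < p)
    (h : Tendsto (frequency A ω) atTop (𝓝 p)) : {j | ω ∈ A j}.Infinite := by
  intro hfin
  have h1 : ∀ᶠ j in atTop, (ω ∈ A j ↔ ω ∈ (∅ : Set Ω)) := by
    filter_upwards [Nat.cofinite_eq_atTop.ge hfin.compl_mem_cofinite] with j hj
    simpa using hj
  have h2 := tendsto_frequency_congr (B := fun _ => ∅) h1 h
  have h3 : frequency (fun _ => (∅ : Set Ω)) ω = fun _ => 0 := by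
    ext n
    simp [frequency]
  rw [h3] at h2
  exact hp.ne (tendsto_nhds_unique tendsto_const_nhds h2)

/-- No tree rooted before block `j` catches up after block `j`. -/
def Robust {ι : Type*} [Add ι] [NatCast ι] [LT ι] [LE ι] (ω : Coord ι → ℝ) (j : ι) : Prop :=
  ∀ i, i < j → ∀ m : ℕ, j ≤ i + m → ¬ Catches ω i m

theorem robust_int_iff (ω : Coord ℤ → ℝ) (j : ℤ) : Robust ω j ↔ ω ∈ good Set.univ j := by
  refine ⟨fun h a b _ => h _ (by omega) _ (by push_cast; omega), fun h i hi m hm => ?_⟩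
  have := h (j - 1 - i).toNat (i + m - j).toNat (Set.mem_univ _)
  convert this using 2 <;> omega

theorem robust_nat_iff (ω : Coord ℤ → ℝ) (j : ℕ) :
    Robust (fun q : Coord ℕ =>
      ω (Sum.map (fun n : ℕ => (n : ℤ)) (Prod.map (fun n : ℕ => (n : ℤ)) id) q)) j ↔ ω ∈ good {x | x.1 < j} (j : ℤ) := by
  have hc : ∀ i m : ℕ, Catches (fun q : Coord ℕ =>
      ω (Sum.map (fun n : ℕ => (n : ℤ)) (Prod.map (fun n : ℕ => (n : ℤ)) id) q)) i m
      ↔ Catches ω (i : ℤ) m := by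
    intro i m
    simp [Catches, Overtakes]
  refine ⟨fun h a b hab => ?_, fun h i hi m hm => ?_⟩
  · have hab' : a < j := hab
    have h1 := h (j - 1 - a) (by omega) (a + b + 1) (by simp only [Nat.cast_id]; omega)
    rw [hc] at h1
    convert h1 using 2
    omega
  · simp only [Nat.cast_id] at hm
    rw [hc]
    have h1 := h (j - 1 - i) (i + m - j) (show j - 1 - i < j by omega)
    convert h1 using 2 <;> omega

theorem measurableSet_robust {ι : Type*} [Countable ι] [Add ι] [NatCast ι] [LT ι] [LE ι] (j : ι) :
    MeasurableSet {ω : Coord ι → ℝ | Robust ω j} := by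
  have h : {ω : Coord ι → ℝ | Robust ω j}
      = ⋂ (i : ι) (_ : i < j) (m : ℕ) (_ : j ≤ i + m), {ω | Catches ω i m}ᶜ := by
    ext
    simp [Robust]
  rw [h]
  exact MeasurableSet.iInter fun i => MeasurableSet.iInter fun _ => MeasurableSet.iInter fun m =>
    MeasurableSet.iInter fun _ => (measurableSet_overtakes
      (R := fun (ω : Coord ι → ℝ) l => ω (.inl l))
      (X := fun (ω : Coord ι → ℝ) k u n => ω (.inr (k, u, n))) (fun l _ => measurable_pi_apply _)
      fun u n => measurable_pi_apply _).compl

theorem measurable_frequency {Ω : Type*} [MeasurableSpace Ω] {A : ℕ → Set Ω}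
    (hA : ∀ j, MeasurableSet (A j)) (n : ℕ) : Measurable fun ω => frequency A ω n := by
  simp_rw [frequency_eq]
  exact (Finset.measurable_sum _ fun j _ => measurable_const.indicator (hA j)).div_const _

theorem ae_tendsto_frequency_robust_nat {lamH lamA : ℝ} (hA : 0 < lamA)
    (hlt : lamA * Real.exp 1 < lamH) :
    ∀ᵐ ω ∂(canon lamH lamA ℕ), Tendsto (frequency (fun j : ℕ => {ω | Robust ω j}) ω) atTop
      (𝓝 ((canon lamH lamA ℤ).real (good Set.univ 0))) := by
  have hH : 0 < lamH := lt_trans (by positivity) hlt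
  have hm : Measurable fun (ω : Coord ℤ → ℝ) (q : Coord ℕ) =>
      ω (Sum.map (fun n : ℕ => (n : ℤ)) (Prod.map (fun n : ℕ => (n : ℤ)) id) q) :=
    measurable_pi_lambda _ fun q => measurable_pi_apply _
  rw [← map_precomp_canon (ι := ℤ) hH hA (f := fun n : ℕ => (n : ℤ)) Nat.cast_injective]
  refine (ae_map_iff hm.aemeasurable (measurableSet_tendsto _
    (measurable_frequency fun j => measurableSet_robust j))).2 ?_
  filter_upwards [ae_tendsto_frequency_good hA hlt, ae_eventually_good_iff hA hlt] with ω h1 h2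
  refine tendsto_frequency_congr ?_ h1
  filter_upwards [h2] with j hj
  rw [hj]
  exact (robust_nat_iff ω j).symm

/-! ### The convergence events of a model -/

theorem birth_drop_le {X : List ℕ → ℕ → ℝ} (hX : ∀ u n, 0 ≤ X u n) (v : List ℕ) (k : ℕ) :
    birth X (v.drop k) ≤ birth X v := by
  induction v generalizing k with
  | nil => simp
  | cons n u ih =>
    cases k with
    | zero => simp
    | succ k =>
      rw [List.drop_succ_cons, birth]
      exact (ih k).trans (le_add_of_nonneg_right (Finset.sum_nonneg fun _ _ => hX _ _))

/-- A block of depth at least `m` has an ancestor of depth exactly `m`, obtained by dropping leading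
letters, and the ancestor is born no later. The case `m = 0` fails for `t < 0`, where the supremum
over no blocks is `0`. -/
theorem depth_lt_iff {X : List ℕ → ℕ → ℝ} (hX : ∀ u n, 0 ≤ X u n) (t : ℝ) {m : ℕ} (hm : 0 < m) :
    depth X t < m ↔ ∀ v : List ℕ, v.length = m → t < birth X v := by
  constructor
  · rintro h v rfl
    by_contra! hv
    exact h.not_ge (le_iSup₂ (f := fun (v : List ℕ) (_ : birth X v ≤ t) => (v.length : ℕ∞)) v hv)
  · intro h
    have h1 : depth X t ≤ ((m - 1 : ℕ) : ℕ∞) := by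
      refine iSup₂_le fun v hv => ?_
      rw [Nat.cast_le]
      by_contra! hlt
      exact (h (v.drop (v.length - m)) (by simp; omega)).not_ge ((birth_drop_le hX v _).trans hv)
    exact h1.trans_lt (Nat.cast_lt.2 (by omega))

/-! ### Catching up along a fixed sample path. -/

section Deterministic

variable {ι : Type*} [CommSemiring ι] [LinearOrder ι] [IsStrictOrderedRing ι]

theorem strictMono_of_lt_add_one (hι : ∀ i j : ι, i ≤ j → ∃ m : ℕ, j = i + m) {τ : ι → ℝ}
    (hτ : ∀ k, τ k < τ (k + 1)) :
    StrictMono τ := by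
  have h1 : ∀ (i : ι) (m : ℕ), τ i < τ (i + (m + 1 : ℕ)) := by
    intro i m
    induction m with
    | zero => simpa using hτ i
    | succ m ih =>
      have h := hτ (i + (m + 1 : ℕ))
      rw [add_assoc, ← Nat.cast_succ] at h
      exact ih.trans h
  intro i j hij
  obtain ⟨m, rfl⟩ := hι i j hij.le
  cases m with
  | zero => simp at hij
  | succ m => exact h1 i m

theorem honestCount_eq (hι : ∀ i j : ι, i ≤ j → ∃ m : ℕ, j = i + m) {τ : ι → ℝ}
    (hτ : ∀ k, τ k < τ (k + 1)) {i : ι} {m : ℕ} {t : ℝ} (h1 : τ (i + m) ≤ t)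
    (h2 : t < τ (i + (m + 1 : ℕ))) : honestCount τ (τ i) t = m := by
  have hs := strictMono_of_lt_add_one hι hτ
  have h : {k : ι | τ i < τ k ∧ τ k ≤ t}
      = (fun l : ℕ => i + (l : ι)) '' (Finset.Ioc 0 m : Finset ℕ) := by
    ext k
    simp only [Set.mem_ofPred_eq, Set.mem_image, Finset.coe_Ioc, Set.mem_Ioc]
    constructor
    · rintro ⟨h3, h4⟩
      obtain ⟨l, rfl⟩ := hι i k (hs.lt_iff_lt.1 h3).le
      refine ⟨l, ⟨?_, ?_⟩, rfl⟩
      · simpa using hs.lt_iff_lt.1 h3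
      · have h5 := hs.lt_iff_lt.1 (h4.trans_lt h2)
        rw [add_lt_add_iff_left, Nat.cast_lt] at h5
        omega
    · rintro ⟨l, ⟨h3, h4⟩, rfl⟩
      refine ⟨hs ?_, (hs.monotone ?_).trans h1⟩
      · simpa using h3
      · simpa using h4
  have hinj : (fun l : ℕ => i + (l : ι)).Injective := fun a b hab => by simpa using hab
  rw [honestCount, h, hinj.encard_image, Set.encard_coe_eq_coe_finsetCard, Nat.card_Ioc, tsub_zero]

theorem sum_range_gaps (τ : ι → ℝ) (i : ι) (m : ℕ) :
    ∑ l ∈ Finset.range m, (τ (i + l + 1) - τ (i + l)) = τ (i + m) - τ i := by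
  have h := Finset.sum_range_sub (fun l : ℕ => τ (i + l)) m
  simpa [add_assoc] using h

/-- On `[τ (i + m), τ (i + m + 1))` the honest count is constantly `m`, while the depth can only
grow. The tree therefore catches up there exactly when a depth-`m` block is born strictly before the
right endpoint. -/
theorem forall_depth_lt_iff (hι : ∀ i j : ι, i ≤ j → ∃ m : ℕ, j = i + m) {τ : ι → ℝ}
    (hτ : ∀ k, τ k < τ (k + 1))
    (hdiv : ∀ (i : ι) (x : ℝ), ∃ m : ℕ, x < τ (i + m))
    {X : ι → List ℕ → ℕ → ℝ} (hX : ∀ i u n, 0 ≤ X i u n) {i j : ι} (hij : i < j) :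
    (∀ t, τ j < t → depth (X i) (t - τ i) < honestCount τ (τ i) t)
      ↔ ∀ m : ℕ, j ≤ i + m → ¬ Overtakes (fun l => τ (l + 1) - τ l) X i m := by
  have hs := strictMono_of_lt_add_one hι hτ
  constructor
  · rintro h m hm ⟨v, hv, hlt⟩
    have hm0 : 0 < m := by
      have h1 := hij.trans_le hm
      simpa using h1
    rw [sum_range_gaps] at hlt
    have hstep : τ (i + m) < τ (i + (m + 1 : ℕ)) := hs (by simp)
    -- The midpoint keeps `t` strictly after `τ j` even when `i + m = j`.
    set t := max (τ i + birth (X i) v) ((τ (i + m) + τ (i + (m + 1 : ℕ))) / 2)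
    have h1 : (τ (i + m) + τ (i + (m + 1 : ℕ))) / 2 ≤ t := le_max_right _ _
    have h2 : t < τ (i + (m + 1 : ℕ)) := max_lt (by linarith) (by linarith)
    have h3 := h t (by linarith [hs.monotone hm])
    rw [honestCount_eq hι hτ (by linarith) h2, depth_lt_iff (hX i) _ hm0] at h3
    have h4 := h3 v hv
    have h5 : τ i + birth (X i) v ≤ t := le_max_left _ _
    linarith
  · intro h t ht
    classical
    -- The first honest block from `i` on that is mined after `t` determines the interval containing
    -- `t`.
    have hex := hdiv i t
    obtain ⟨m, hm⟩ : ∃ m, Nat.find hex = m + 1 := by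
      refine Nat.exists_eq_succ_of_ne_zero fun h0 => ?_
      have h1 := Nat.find_spec hex
      rw [h0, Nat.cast_zero, add_zero] at h1
      linarith [hs hij]
    have h1 : τ (i + m) ≤ t := not_lt.1 (Nat.find_min hex (by omega))
    have h2 : t < τ (i + (m + 1 : ℕ)) := hm ▸ Nat.find_spec hex
    have h3 : j ≤ i + m := by
      obtain ⟨d, rfl⟩ := hι i j hij.le
      have h4 := hs.lt_iff_lt.1 (ht.trans h2)
      rw [add_lt_add_iff_left, Nat.cast_lt] at h4
      rw [add_le_add_iff_left, Nat.cast_le]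
      omega
    have hm0 : 0 < m := by
      have h4 := hij.trans_le h3
      simpa using h4
    rw [honestCount_eq hι hτ h1 h2, depth_lt_iff (hX i) _ hm0]
    intro v hv
    by_contra! hle
    refine h m h3 ⟨v, hv, ?_⟩
    rw [sum_range_gaps]
    linarith

end Deterministic

theorem ae_canon_unbounded {ι : Type*} [Countable ι] [CommSemiring ι] [LinearOrder ι]
    [IsStrictOrderedRing ι] {lamH lamA : ℝ} (hH : 0 < lamH) (hA : 0 < lamA) :
    ∀ᵐ ω ∂(canon lamH lamA ι), ∀ (i : ι) (x : ℝ),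
      ∃ m : ℕ, x < ∑ l ∈ Finset.range m, ω (.inl (i + l)) := by
  have hnat : ∀ᵐ ω ∂(canon lamH lamA ι), ∀ (i : ι) (N : ℕ),
      ∃ m : ℕ, (N : ℝ) < ∑ l ∈ Finset.range m, ω (.inl (i + l)) := by
    have := isProbabilityMeasure_canon (ι := ι) hH hA
    refine ae_all_iff.2 fun i => ae_all_iff.2 fun N => ?_
    rw [ae_iff, ← measureReal_eq_zero_iff]
    have hinj : (fun l : ℕ => (Sum.inl (i + l) : Coord ι)).Injective := fun a b h => by
      simpa using h
    have hle : ∀ m : ℕ, (canon lamH lamA ι).real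
        {ω | ¬ ∃ m : ℕ, (N : ℝ) < ∑ l ∈ Finset.range m, ω (.inl (i + l))}
        ≤ Real.exp (1 * N) * (lamH / (lamH + 1)) ^ m := by
      intro m
      have h := measure_sum_exp_le hH (fun l : ℕ => measurable_pi_apply _)
        ((iIndepFun_canon (ι := ι) hH hA).precomp hinj) (s := Finset.range m)
        (fun l _ => map_eval_canon hH hA _) zero_le_one (N : ℝ)
      rw [Finset.card_range] at h
      refine (measureReal_mono fun ω hω => ?_).trans h
      rw [Set.mem_ofPred_eq, Finset.sum_apply]
      exact not_lt.1 fun h => hω ⟨m, h⟩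
    have hlim := (tendsto_pow_atTop_nhds_zero_of_lt_one (r := lamH / (lamH + 1)) (by positivity)
      (by rw [div_lt_one (by positivity)]; linarith)).const_mul (Real.exp (1 * N))
    rw [mul_zero] at hlim
    exact le_antisymm (ge_of_tendsto' hlim hle) measureReal_nonneg
  filter_upwards [hnat] with ω hω i x
  obtain ⟨N, hN⟩ := exists_nat_gt x
  obtain ⟨m, hm⟩ := hω i N
  exact ⟨m, hN.trans hm⟩

/-! ### Transfer from an arbitrary model to the canonical one. -/

section Model

variable {ι Ω : Type*} [MeasurableSpace Ω] {P : Measure Ω} {lamH lamA : ℝ} {τ : ι → Ω → ℝ}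
  {X : ι → List ℕ → ℕ → Ω → ℝ}

/-- The gaps and the waiting times of a model. -/
def coords [Add ι] [One ι] (τ : ι → Ω → ℝ) (X : ι → List ℕ → ℕ → Ω → ℝ) (ω : Ω) :
    Coord ι → ℝ :=
  Sum.elim (fun j => τ (j + 1) ω - τ j ω) fun q => X q.1 q.2.1 q.2.2 ω

theorem IsZeroDelayModel.hasLaw_coords [Countable ι] [Add ι] [One ι]
    (h : IsZeroDelayModel lamH lamA P τ X) : HasLaw (coords τ X) (canon lamH lamA ι) P := by
  have hlaw : ∀ q : Coord ι, HasLaw (Sum.elim (fun (j : ι) (ω : Ω) => τ (j + 1) ω - τ j ω)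
      (fun (q : ι × List ℕ × ℕ) (ω : Ω) => X q.1 q.2.1 q.2.2 ω) q)
      (expMeasure (rate lamH lamA q)) P := by
    rintro (j | q)
    · exact h.gap_law j
    · exact h.wait_law _ _ _
  have h1 := h.indep.hasLaw_infinitePi hlaw
    (aemeasurable_pi_iff.2 fun q => (hlaw q).aemeasurable)
  have h2 : coords τ X = fun ω q => Sum.elim (fun (j : ι) (ω : Ω) => τ (j + 1) ω - τ j ω)
      (fun (q : ι × List ℕ × ℕ) (ω : Ω) => X q.1 q.2.1 q.2.2 ω) q ω := by
    ext ω q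
    cases q <;> rfl
  rw [h2]
  exact h1

theorem IsZeroDelayModel.ae_mem_convergenceEvent_iff [Countable ι] [CommSemiring ι]
    [LinearOrder ι] [IsStrictOrderedRing ι] (hι : ∀ i j : ι, i ≤ j → ∃ m : ℕ, j = i + m)
    (hH : 0 < lamH) (hA : 0 < lamA) (h : IsZeroDelayModel lamH lamA P τ X) :
    ∀ᵐ ω ∂P, ∀ j, ω ∈ convergenceEvent τ X j ↔ Robust (coords τ X ω) j := by
  have hlaw := h.hasLaw_coords
  have h1 := ae_pos_canon (ι := ι) hH hA
  have h2 := ae_canon_unbounded (ι := ι) hH hA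
  rw [← hlaw.map_eq] at h1 h2
  filter_upwards [ae_of_ae_map hlaw.aemeasurable h1, ae_of_ae_map hlaw.aemeasurable h2]
    with ω hpos hdiv j
  have hτ : ∀ k, τ k ω < τ (k + 1) ω := fun k => sub_pos.1 (hpos (.inl k))
  have hdiv' : ∀ (i : ι) (x : ℝ), ∃ m : ℕ, x < τ (i + m) ω := by
    intro i x
    obtain ⟨m, hm⟩ := hdiv i (x - τ i ω)
    have h3 := sum_range_gaps (fun k => τ k ω) i m
    have h4 : x - τ i ω < τ (i + m) ω - τ i ω := h3 ▸ hm
    exact ⟨m, by linarith⟩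
  have key := fun (i : ι) (hij : i < j) => forall_depth_lt_iff hι (τ := fun k => τ k ω) hτ hdiv'
    (X := fun i u n => X i u n ω) (fun i u n => (hpos (.inr (i, u, n))).le) hij
  simp only [convergenceEvent, Set.mem_iInter]
  exact forall₂_congr key

end Model

end NaS

theorem mainTheorem6 (lamH lamA : ℝ) (hA : 0 < lamA) (hlt : lamA * Real.exp 1 < lamH) :
    ∃ p : ℝ, 0 < p ∧
      -- the process that starts with block `0`
      (∀ (Ω : Type*) [MeasurableSpace Ω] (P : Measure Ω) [IsProbabilityMeasure P]
        (τ : ℕ → Ω → ℝ) (X : ℕ → List ℕ → ℕ → Ω → ℝ), NaS.IsZeroDelayModel lamH lamA P τ X →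
          ∀ᵐ ω ∂P, {j : ℕ | ω ∈ NaS.convergenceEvent τ X j}.Infinite ∧
            Tendsto (NaS.frequency (fun j => NaS.convergenceEvent τ X j) ω) atTop (𝓝 p)) ∧
      -- its two-sided extension
      (∀ (Ω : Type*) [MeasurableSpace Ω] (P : Measure Ω) [IsProbabilityMeasure P]
        (τ : ℤ → Ω → ℝ) (X : ℤ → List ℕ → ℕ → Ω → ℝ), NaS.IsZeroDelayModel lamH lamA P τ X →
          (∀ j : ℤ, P.real (NaS.convergenceEvent τ X j) = p) ∧
          ∀ᵐ ω ∂P, {j : ℕ | ω ∈ NaS.convergenceEvent τ X (j : ℤ)}.Infinite ∧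
            Tendsto (NaS.frequency (fun j : ℕ => NaS.convergenceEvent τ X (j : ℤ)) ω)
              atTop (𝓝 p)) := by
  have hH : 0 < lamH := lt_trans (by positivity) hlt
  have hprob := NaS.isProbabilityMeasure_canon (ι := ℤ) hH hA
  have hp : 0 < (NaS.canon lamH lamA ℤ).real (NaS.good Set.univ 0) :=
    ENNReal.toReal_pos (NaS.measure_good_univ_pos hA hlt) (measure_ne_top _ _)
  refine ⟨_, hp, fun Ω _ P _ τ X h => ?_, fun Ω _ P _ τ X h => ⟨fun j => ?_, ?_⟩⟩
  · have hlaw := h.hasLaw_coords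
    have hfreq := NaS.ae_tendsto_frequency_robust_nat hA hlt
    rw [← hlaw.map_eq] at hfreq
    filter_upwards [ae_of_ae_map hlaw.aemeasurable hfreq, h.ae_mem_convergenceEvent_iff
      (fun i j hij => ⟨j - i, by simp only [Nat.cast_id]; omega⟩) hH hA] with ω h1 h2
    have h3 := NaS.tendsto_frequency_congr (B := fun j => NaS.convergenceEvent τ X j) (ω' := ω)
      (Eventually.of_forall fun j => (h2 j).symm) h1
    exact ⟨NaS.infinite_of_tendsto_frequency hp h3, h3⟩
  · have hlaw := h.hasLaw_coords
    have hiff := h.ae_mem_convergenceEvent_iff (fun i j hij => ⟨(j - i).toNat, by omega⟩) hH hA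
    -- Almost sure equality with a preimage of a measurable set is enough; measurability of the
    -- convergence event itself is not needed.
    have h1 : NaS.convergenceEvent τ X j =ᵐ[P] NaS.coords τ X ⁻¹' NaS.good Set.univ j := by
      filter_upwards [hiff] with ω hω
      exact propext ((hω j).trans (NaS.robust_int_iff _ j))
    rw [measureReal_def, measure_congr h1, ← Measure.map_apply_of_aemeasurable hlaw.aemeasurable
      (NaS.measurableSet_good _ _), hlaw.map_eq, NaS.measure_good_eq hH hA, measureReal_def]
  · have hlaw := h.hasLaw_coords
    have hfreq : ∀ᵐ η ∂(P.map (NaS.coords τ X)), Tendsto (NaS.frequency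
        (fun j : ℕ => NaS.good Set.univ (j : ℤ)) η) atTop
        (𝓝 ((NaS.canon lamH lamA ℤ).real (NaS.good Set.univ 0))) := by
      rw [hlaw.map_eq]
      exact NaS.ae_tendsto_frequency_good hA hlt
    filter_upwards [ae_of_ae_map hlaw.aemeasurable hfreq,
      h.ae_mem_convergenceEvent_iff (fun i j hij => ⟨(j - i).toNat, by omega⟩) hH hA] with ω h1 h2
    have h3 := NaS.tendsto_frequency_congr (B := fun j : ℕ => NaS.convergenceEvent τ X (j : ℤ))
      (ω' := ω) (Eventually.of_forall fun j =>
        ((h2 j).trans (NaS.robust_int_iff _ j)).symm) h1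
    exact ⟨NaS.infinite_of_tendsto_frequency hp h3, h3⟩
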